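/- Let $n\ge 2$, $L\ge 1$, $t_l=l/L$ for $l=1,\dots,L$, and let $H\in\mathbb R^{L\times L}$ be an orthogonal matrix such that $$\|H^T\omega\|_\infty\le \|\omega\|_1/\sqrt L\ \text{ for every } \omega\in\{0,1\}^L,\qquad H\mathbf 1=\sqrt L\,e_1 .$$ A dynamic graphon is a function $f:[0,1]^3\to[0,1]$ with $f(x,y,t)=f(y,x,t)$. Given $f$ and node positions $\zeta=(\zeta_1,\dots,\zeta_n)\in[0,1]^n$, put $\Lambda_{i,j,l}=f(\zeta_i,\zeta_j,t_l)$ for $i\ne j$ and $\Lambda_{i,i,l}=0$. One observes a symmetric $0$-$1$ tensor $B$ with zero diagonal whose entries $B_{i,j,l}$, $i<j$, $1\le l\le L$, are independent Bernoulli$(\Lambda_{i,j,l})$ variables; $\mathbb P_\Lambda$ denotes their law. An estimator $\hat\Lambda\in\mathbb R^{n\times n\times L}$ is any function of $B$, and $\|\cdot\|$ is the Euclidean norm of tensors. For a dynamic graphon $f$ let $v(x,y)=H\,(f(x,y,t_1),\dots,f(x,y,t_L))^T$. For $\nu_1,\nu_2,K_1,K_2>0$ and an integer $r\ge1$, the class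 $\Sigma_r(\nu_1,\nu_2,K_1,K_2)$ consists of the dynamic graphons $f$ with $$\sum_{l=1}^L (l-1)^{2\nu_2}v_l(x,y)^2\le K_2\quad\text{for all }x,y\in[0,1]$$ for which there are $0=\beta_0<\beta_1<\dots<\beta_r=1$ such that, with $I_1=[\beta_0,\beta_1]$ and $I_i=(\beta_{i-1},\beta_i]$ for $i\ge2$, every $v_l$ is Hölder smooth of order $\nu_1$ on every rectangle $I_i\times I_j$: if $m$ is the largest integer strictly less than $\nu_1$, then $v_l$ is $m$ times continuously differentiable on $I_i\times I_j$ and every partial derivative $D$ of $v_l$ of order $m$ satisfies $$[D(x,y)-D(x',y')]^2\le K_1\,[|x-x'|+|y-y'|]^{2(\nu_1-m)},\qquad x,x'\in I_i,\ y,y'\in I_j .$$ (For $\nu_1\le1$ this is the condition $[v_l(x,y)-v_l(x',y')]^2\le K_1[|x-x'|+|y-y'|]^{2\nu_1}$.) The class $\Sigma_r(\infty,\nu_2,K_2)$ is defined in the same way, with every $v_l$ required to be constant on every rectangle $I_i\times I_j$. Suppose $\nu_2\ge 1/2$. (a) Piecewise constant regime. There is a constant $C>0$ depending only on $\nu_2$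 and $K_2$ such that for all $n$, $L$, $r$ with $2\le r\le n$ (so that $r$ may depend on $n$ and $L$) and all $H$ as above, $$\inf_{\hat\Lambda}\ \sup_{f\in\Sigma_r(\infty,\nu_2,K_2),\ \zeta\in[0,1]^n}\mathbb P_\Lambda\Big\{\frac{\|\hat\Lambda-\Lambda\|^2}{n^2L}\ge\Delta\Big\}\ge\frac14,\qquad \Delta=C\min\Big\{\frac1L\Big[\Big(\frac rn\Big)^2\Big]^{\frac{2\nu_2}{2\nu_2+1}},\ \Big(\frac rn\Big)^2\Big\}+\frac{C\log r}{nL}.$$ (b) Piecewise smooth regime. There is a constant $C>0$ depending only on $\nu_1,\nu_2,K_1,K_2$ such that for all $r\ge1$, $n\ge2$, $L\ge1$ and all $H$ as above, $$\inf_{\hat\Lambda}\ \sup_{f\in\Sigma_r(\nu_1,\nu_2,K_1,K_2),\ \zeta\in[0,1]^n}\mathbb P_\Lambda\Big\{\frac{\|\hat\Lambda-\Lambda\|^2}{n^2L}\ge\Delta\Big\}\ge\frac14,\qquad \Delta=C\min\Big\{\frac1L\Big(\frac1{n^2}\Big)^{\frac{2\nu_1\nu_2}{(\nu_1+1)(2\nu_2+1)}},\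 \Big(\frac1{n^2}\Big)^{\frac{\nu_1}{\nu_1+1}}\Big\}+\frac{C\log n}{nL}.$$ -/

import Mathlib

open MeasureTheory
open scoped unitInterval ENNReal

namespace DynamicGraphon

noncomputable section

/-- The observation times `t_l = l / L`, `l = 1, …, L` (the index `l : Fin L` starts at `0`). -/
def time {L : ℕ} (l : Fin L) : I :=
  ⟨((l : ℝ) + 1) / (L : ℝ), by
    have hl : (l : ℝ) + 1 ≤ (L : ℝ) := by exact_mod_cast l.isLt
    have h0 : (0 : ℝ) ≤ (l : ℝ) + 1 := by positivity
    have hL : (0 : ℝ) < (L : ℝ) := by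
      have : 0 < L := l.pos
      exact_mod_cast this
    exact ⟨div_nonneg h0 hL.le, (div_le_one hL).2 hl⟩⟩

/-- The conditions on the transform `H`: `‖Hᵀ ω‖_∞ ≤ ‖ω‖₁ / √L` for every binary vector `ω`, and
`H 𝟏 = √L e₁`. -/
def TransformCondition {L : ℕ} (H : Matrix (Fin L) (Fin L) ℝ) : Prop :=
  (∀ ω : Fin L → ℝ, (∀ l, ω l = 0 ∨ ω l = 1) →
      ∀ k, |H.transpose.mulVec ω k| ≤ (∑ l, |ω l|) / √(L : ℝ)) ∧
    H.mulVec (fun _ => (1 : ℝ)) = fun l : Fin L => if (l : ℕ) = 0 then √(L : ℝ) else 0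

/-- The coefficients `v(x, y) = H (f(x, y, t_1), …, f(x, y, t_L))ᵀ`. -/
def coeff {L : ℕ} (H : Matrix (Fin L) (Fin L) ℝ) (f : I → I → I → I) (l : Fin L) (x y : I) : ℝ :=
  H.mulVec (fun k => (f x y (time k) : ℝ)) l

/-- `0 = β₀ < β₁ < ⋯ < β_r = 1`. -/
def IsPartition {r : ℕ} (β : Fin (r + 1) → ℝ) : Prop :=
  β 0 = 0 ∧ β (Fin.last r) = 1 ∧ StrictMono β

/-- The pieces `[β₀, β₁]`, `(β₁, β₂]`, …, `(β_{r-1}, β_r]`, which partition `[0, 1]`. -/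
def piece {r : ℕ} (β : Fin (r + 1) → ℝ) (i : Fin r) : Set ℝ :=
  {x | (β i.castSucc < x ∨ ((i : ℕ) = 0 ∧ x = β i.castSucc)) ∧ x ≤ β i.succ}

/-- `∑_l (l - 1)^{2 ν₂} v_l(x, y)² ≤ K₂` for all `x, y` (here `l` starts at `0`, so `l - 1` of the
one-based numbering is `l`). -/
def TimeSmooth {L : ℕ} (H : Matrix (Fin L) (Fin L) ℝ) (ν₂ K₂ : ℝ) (f : I → I → I → I) : Prop :=
  ∀ x y : I, ∑ l : Fin L, (l : ℝ) ^ (2 * ν₂) * coeff H f l x y ^ 2 ≤ K₂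

/-- Each `v_l` is constant on every rectangle of the grid given by `β` (the case `ν₁ = ∞`). -/
def SpaceConstant {L r : ℕ} (H : Matrix (Fin L) (Fin L) ℝ) (β : Fin (r + 1) → ℝ)
    (f : I → I → I → I) : Prop :=
  ∀ (l : Fin L) (i j : Fin r) (x x' y y' : I),
    (x : ℝ) ∈ piece β i → (x' : ℝ) ∈ piece β i → (y : ℝ) ∈ piece β j → (y' : ℝ) ∈ piece β j →
      coeff H f l x y = coeff H f l x' y'

/-- The coefficient `v_l` as a function on the plane (only its values on `[0, 1]²` matter). -/
def coeffPlane {L : ℕ} (H : Matrix (Fin L) (Fin L) ℝ) (f : I → I → I → I) (l : Fin L)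
    (z : ℝ × ℝ) : ℝ :=
  coeff H f l (Set.projIcc 0 1 zero_le_one z.1) (Set.projIcc 0 1 zero_le_one z.2)

/-- The largest integer strictly less than `ν` (for `ν > 0`). -/
def holderOrder (ν : ℝ) : ℕ := ⌈ν⌉₊ - 1

/-- The coordinate directions of the plane. -/
def direction (a : Fin 2) : ℝ × ℝ := if a = 0 then (1, 0) else (0, 1)

/-- Hölder smoothness of order `ν₁` of every `v_l` on every rectangle of the grid given by `β`.
With `m` the largest integer strictly less than `ν₁`, `v_l` is `m` times continuously differentiable
on the rectangle and each partial derivative `D` of order `m` satisfies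
`[D(x, y) - D(x', y')]² ≤ K₁ [|x - x'| + |y - y'|]^{2 (ν₁ - m)}`.
For `0 < ν₁ ≤ 1` one has `m = 0`, and this reads
`[v_l(x, y) - v_l(x', y')]² ≤ K₁ [|x - x'| + |y - y'|]^{2 ν₁}`. -/
def SpaceHolder {L r : ℕ} (H : Matrix (Fin L) (Fin L) ℝ) (β : Fin (r + 1) → ℝ) (ν₁ K₁ : ℝ)
    (f : I → I → I → I) : Prop :=
  ∀ (l : Fin L) (i j : Fin r),
    ContDiffOn ℝ (holderOrder ν₁ : ℕ) (coeffPlane H f l) (piece β i ×ˢ piece β j) ∧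
    ∀ z ∈ piece β i ×ˢ piece β j, ∀ z' ∈ piece β i ×ˢ piece β j,
      ∀ s : Fin (holderOrder ν₁) → Fin 2,
        (iteratedFDerivWithin ℝ (holderOrder ν₁) (coeffPlane H f l) (piece β i ×ˢ piece β j) z
              (fun k => direction (s k)) -
            iteratedFDerivWithin ℝ (holderOrder ν₁) (coeffPlane H f l) (piece β i ×ˢ piece β j) z'
              (fun k => direction (s k))) ^ 2 ≤
          K₁ * (|z.1 - z'.1| + |z.2 - z'.2|) ^ (2 * (ν₁ - holderOrder ν₁))

/-- The class `Σ(∞, ν₂, K₂)` of dynamic graphons that are piecewise constant in `(x, y)`, with `r`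
pieces. -/
def constClass {L : ℕ} (H : Matrix (Fin L) (Fin L) ℝ) (r : ℕ) (ν₂ K₂ : ℝ) :
    Set (I → I → I → I) :=
  {f | (∀ x y s, f x y s = f y x s) ∧
    (∃ β : Fin (r + 1) → ℝ, IsPartition β ∧ SpaceConstant H β f) ∧ TimeSmooth H ν₂ K₂ f}

/-- The class `Σ(ν₁, ν₂, K₁, K₂)` of dynamic graphons that are piecewise smooth in `(x, y)`, with
`r` pieces. -/
def smoothClass {L : ℕ} (H : Matrix (Fin L) (Fin L) ℝ) (r : ℕ) (ν₁ ν₂ K₁ K₂ : ℝ) :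
    Set (I → I → I → I) :=
  {f | (∀ x y s, f x y s = f y x s) ∧
    (∃ β : Fin (r + 1) → ℝ, IsPartition β ∧ SpaceHolder H β ν₁ K₁ f) ∧ TimeSmooth H ν₂ K₂ f}

/-- The tensor of connection probabilities: `Λ_{i,j,l} = f(ζ_i, ζ_j, t_l)` for `i ≠ j`, and
`Λ_{i,i,l} = 0`. -/
def probTensor {n L : ℕ} (f : I → I → I → I) (ζ : Fin n → I) :
    Fin n → Fin n → Fin L → I :=
  fun i j l => if i = j then 0 else f (ζ i) (ζ j) (time l)

/-- The pairs of nodes `i < j`. -/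
abbrev Edge (n : ℕ) : Type := {e : Fin n × Fin n // e.1 < e.2}

/-- An observed dynamic network: the symmetric adjacency tensor with zero diagonal, given by its
entries `B_{i,j,l}` with `i < j`. -/
abbrev Observation (n L : ℕ) : Type := Edge n → Fin L → Bool

/-- The law `P_Λ` of the observed network: the entries `B_{i,j,l}`, `i < j`, are independent
Bernoulli variables with success probabilities `Λ_{i,j,l}`. -/
def networkLaw {n L : ℕ} (Λ : Fin n → Fin n → Fin L → I) : Measure (Observation n L) :=
  Measure.pi fun e => Measure.pi fun l =>
    ProbabilityTheory.bernoulliMeasure true false (Λ e.1.1 e.1.2 l)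

/-- The normalized squared error `‖Λ' - Λ‖² / (n² L)`. -/
def normalizedError {n L : ℕ} (Λ' : Fin n → Fin n → Fin L → ℝ) (Λ : Fin n → Fin n → Fin L → I) :
    ℝ :=
  (∑ i, ∑ j, ∑ l, (Λ' i j l - (Λ i j l : ℝ)) ^ 2) / ((n : ℝ) ^ 2 * (L : ℝ))

/-- The minimax probability
`inf_{Λ'} sup_{f ∈ 𝓕, ζ ∈ [0, 1]ⁿ} P_Λ (‖Λ' - Λ‖² / (n² L) ≥ Δ)` with `Λ_{i,j,l} = f(ζ_i, ζ_j, t_l)`,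
the infimum being over all estimators `Λ'`, i.e. all functions of the observed network. -/
def minimaxProb (n L : ℕ) (𝓕 : Set (I → I → I → I)) (Δ : ℝ) : ℝ≥0∞ :=
  ⨅ Λ' : Observation n L → Fin n → Fin n → Fin L → ℝ,
    ⨆ f ∈ 𝓕, ⨆ ζ : Fin n → I,
      networkLaw (probTensor f ζ) {b | Δ ≤ normalizedError (Λ' b) (probTensor f ζ)}

/-- The rate in the piecewise constant regime, up to a constant factor. -/
def constRate (n L r : ℕ) (ν₂ : ℝ) : ℝ :=
  min ((1 / (L : ℝ)) * (((r : ℝ) / n) ^ 2) ^ (2 * ν₂ / (2 * ν₂ + 1))) (((r : ℝ) / n) ^ 2) +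
    Real.log r / (n * L)

/-- The rate in the piecewise smooth regime, up to a constant factor. -/
def smoothRate (n L : ℕ) (ν₁ ν₂ : ℝ) : ℝ :=
  min ((1 / (L : ℝ)) * (1 / (n : ℝ) ^ 2) ^ (2 * ν₁ * ν₂ / ((ν₁ + 1) * (2 * ν₂ + 1))))
      ((1 / (n : ℝ) ^ 2) ^ (ν₁ / (ν₁ + 1))) +
    Real.log n / (n * L)

end

end DynamicGraphon

/-! Each rate is a sum of two terms, and a sum is at most twice its larger term, so the two terms
are bounded separately (`minimaxProb_ge_of_sum`). Both bounds come from a cube of parameters over a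
finite alphabet. If altering one coordinate changes the law little in chi-square, every decoder gets
a constant fraction of the coordinates wrong with probability at least 1/4
(`exists_hammingDist_prob_ge`). If the squared distance of the tensors also grows linearly in the
Hamming distance, projecting an estimator onto the cube turns those mistakes into estimation error
(`minimaxProb_ge_of_cube`).

The parameters are written as `1/2 + Hᵀ w`. Orthogonality of `H` makes distances those of the
coefficients `w`, and the bound on the entries of `H` keeps probabilities in `[1/4, 3/4]` once `w`
is small in l1 norm.

Nonparametric term: the nodes are dealt into `h` blocks and, for each pair of distinct blocks, each
of the first `N` coefficients is either 0 or `γ`. One switch affects about `(n/h)²` node pairs, so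
it is undetectable when `γ` is of order at most `h/n`. Temporal smoothness allows `N` of order
`γ^(-2/(2ν₂+1))`, capped by `L`, and the error is of order `γ² N / L`. In the constant class `h =
r`; in the smooth class the blocks are the cells of a grid of bumps, and the Hölder amplitude
`h^(-ν₁)` meets `h/n` at `h = n^(1/(ν₁+1))`.

Clustering term: the graphon is fixed and only the positions of half of the nodes are unknown.
Labels are vectors over the field with two elements, and two nodes connect according to the dot
product of their labels. Anchor nodes run through all nonzero labels, so two different labels
disagree on at least a quarter of the anchors. A label takes `2^k` values, so a shift `η` with `η² n
L` of order `k` stays undetectable. This gives an error of order `k/(nL)`, with `k` of order `log r`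
or `log n`. -/

namespace DynamicGraphon

/-! ### Assouad's lemma over a finite alphabet -/

section Assouad

/-- Averaging over one coordinate of a cube does not change the total. -/
lemma sum_sum_update {κ A : Type*} [Fintype κ] [DecidableEq κ] [Fintype A]
    (F : (κ → A) → ℝ) (k : κ) :
    ∑ θ : κ → A, ∑ a, F (Function.update θ k a) = Fintype.card A * ∑ θ, F θ := by
  classical
  -- Exchanging the `k`-th coordinate with the spare letter is an involution of cube times alphabet,
  -- so it reindexes the double sum.
  have hinv : Function.Involutive
      (fun p : (κ → A) × A => (Function.update p.1 k p.2, p.1 k)) := by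
    rintro ⟨θ, a⟩
    simp
  calc ∑ θ : κ → A, ∑ a, F (Function.update θ k a)
      = ∑ p : (κ → A) × A, F (hinv.toPerm _ p).1 := by
        rw [Fintype.sum_prod_type]; rfl
    _ = ∑ p : (κ → A) × A, F p.1 := Equiv.sum_comp (hinv.toPerm _) (fun p => F p.1)
    _ = _ := by
        rw [Fintype.sum_prod_type]
        simp [Finset.mul_sum]

/-- A chi-square bound on the success probability of a test among several hypotheses. -/
lemma sum_success_le {Ω A : Type*} [Fintype Ω] [Fintype A] [DecidableEq A]
    (P : A → Ω → ℝ) (Q : Ω → ℝ) (hQ : ∀ b, 0 < Q b) (hQ1 : ∑ b, Q b = 1)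
    (hA : 2 ≤ Fintype.card A)
    (hχ : ∀ a, ∑ b, (P a b - Q b) ^ 2 / Q b ≤ (Fintype.card A : ℝ) / 64) (ψ : Ω → A) :
    ∑ a, ∑ b, (if ψ b = a then P a b else 0) ≤ 5 / 8 * (Fintype.card A : ℝ) := by
  set M : ℝ := (Fintype.card A : ℝ) with hM
  have hM2 : (2 : ℝ) ≤ M := by rw [hM]; exact_mod_cast hA
  -- On the event, `P - Q` is at most `(M/16) Q + (4/M) (P-Q)²/Q` by the arithmetic-geometric mean
  -- inequality. The events partition the sample space, so summing gives `1 + M/8`, which is at most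
  -- `5M/8` because `M ≥ 2`.
  have hpt : ∀ a b, (if ψ b = a then P a b else 0) ≤
      (1 + M / 16) * (if ψ b = a then Q b else 0) + 4 / M * ((P a b - Q b) ^ 2 / Q b) := by
    intro a b
    have hq := hQ b
    have h0 : 0 ≤ 4 / M * ((P a b - Q b) ^ 2 / Q b) := by positivity
    split_ifs
    · have key : 4 / M * ((P a b - Q b) ^ 2 / Q b) + M / 16 * Q b - (P a b - Q b)
          = (4 / M) * (1 / Q b) * ((P a b - Q b) - M / 8 * Q b) ^ 2 := by
        field_simp; ring
      have : 0 ≤ (4 / M) * (1 / Q b) * ((P a b - Q b) - M / 8 * Q b) ^ 2 := by positivity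
      linarith
    · simpa using h0
  have hsum : ∑ a, ∑ b, (if ψ b = a then Q b else 0) = 1 := by
    rw [Finset.sum_comm]; simpa using hQ1
  calc ∑ a, ∑ b, (if ψ b = a then P a b else 0)
      ≤ ∑ a, ∑ b, ((1 + M / 16) * (if ψ b = a then Q b else 0) +
          4 / M * ((P a b - Q b) ^ 2 / Q b)) :=
        Finset.sum_le_sum fun a _ => Finset.sum_le_sum fun b _ => hpt a b
    _ = (1 + M / 16) + 4 / M * ∑ a, ∑ b, (P a b - Q b) ^ 2 / Q b := by
        simp only [Finset.sum_add_distrib, ← Finset.mul_sum, hsum, mul_one]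
    _ ≤ (1 + M / 16) + 4 / M * ∑ _a : A, M / 64 := by
        gcongr with a; exact hχ a
    _ = 1 + M / 16 + M / 16 := by
        rw [Finset.sum_const, Finset.card_univ, nsmul_eq_mul, ← hM]; field_simp; ring
    _ ≤ _ := by linarith

/-- Assouad's lemma over a finite alphabet, in probability: some parameter of the cube is estimated
with at least one coordinate in eight wrong, with probability at least `1 / 4`. -/
theorem exists_hammingDist_prob_ge {Ω κ A : Type*} [Fintype Ω] [Fintype κ] [DecidableEq κ]
    [Nonempty κ] [Fintype A] [DecidableEq A] (a₀ : A) (hA : 2 ≤ Fintype.card A)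
    (P : (κ → A) → Ω → ℝ) (hP : ∀ θ b, 0 < P θ b) (hP1 : ∀ θ, ∑ b, P θ b = 1)
    (hχ : ∀ θ k, ∑ b, (P θ b - P (Function.update θ k a₀) b) ^ 2 / P (Function.update θ k a₀) b ≤
      (Fintype.card A : ℝ) / 64) (ψ : Ω → κ → A) :
    ∃ θ, 1 / 4 ≤ ∑ b, if (Fintype.card κ : ℝ) / 8 ≤ hammingDist (ψ b) θ then P θ b else 0 := by
  by_contra! hcon
  set K : ℝ := (Fintype.card κ : ℝ) with hK
  set M : ℝ := (Fintype.card A : ℝ) with hM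
  have hKpos : 0 < K := by rw [hK]; exact_mod_cast Fintype.card_pos
  have hMpos : 0 < M := by rw [hM]; exact_mod_cast (by omega : 0 < Fintype.card A)
  -- With all coordinates but `k` frozen, recovering `θ k` is a test among the letters, with the
  -- letter `a₀` as reference law.
  have hsucc : ∀ k, ∑ θ, ∑ b, (if ψ b k = θ k then P θ b else 0) ≤
      5 / 8 * (Fintype.card (κ → A) : ℝ) := by
    intro k
    have h1 := sum_sum_update (fun θ => ∑ b, (if ψ b k = θ k then P θ b else 0)) k
    have h2 : ∀ θ : κ → A, ∑ a, ∑ b, (if ψ b k = (Function.update θ k a) k then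
        P (Function.update θ k a) b else 0) ≤ 5 / 8 * M := by
      intro θ
      simp only [Function.update_self]
      refine sum_success_le (fun a => P (Function.update θ k a)) (P (Function.update θ k a₀))
        (hP _) (hP1 _) hA (fun a => ?_) (fun b => ψ b k)
      simpa using hχ (Function.update θ k a) k
    have h3 := Finset.sum_le_sum (s := Finset.univ) fun θ _ => h2 θ
    rw [h1, Finset.sum_const, Finset.card_univ, nsmul_eq_mul] at h3
    nlinarith
  have hham : ∀ θ b, (hammingDist (ψ b) θ : ℝ) = K - ∑ k, if ψ b k = θ k then (1 : ℝ) else 0 := by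
    intro θ b
    have h : (hammingDist (ψ b) θ : ℝ) = ∑ k, if ψ b k = θ k then (0 : ℝ) else 1 := by
      simp [hammingDist, Finset.sum_ite]
    rw [h, hK, ← Finset.card_univ, Finset.cast_card, ← Finset.sum_sub_distrib]
    refine Finset.sum_congr rfl fun k _ => ?_
    split_ifs <;> simp
  have hEW : 3 / 8 * K * (Fintype.card (κ → A) : ℝ) ≤
      ∑ θ, ∑ b, P θ b * hammingDist (ψ b) θ := by
    have h1 : ∑ θ, ∑ b, P θ b * hammingDist (ψ b) θ =
        K * Fintype.card (κ → A) - ∑ k, ∑ θ, ∑ b, (if ψ b k = θ k then P θ b else 0) := by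
      rw [Finset.sum_comm (s := Finset.univ (α := κ))]
      have h2 : ∀ θ : κ → A, ∑ b, P θ b * hammingDist (ψ b) θ =
          K - ∑ k, ∑ b, (if ψ b k = θ k then P θ b else 0) := by
        intro θ
        rw [Finset.sum_comm]
        simp only [hham, mul_sub, Finset.sum_sub_distrib, ← Finset.sum_mul, hP1, one_mul,
          Finset.mul_sum, mul_ite, mul_one, mul_zero]
      simp only [h2, Finset.sum_sub_distrib]
      simp [mul_comm]
    rw [h1]
    have h3 := Finset.sum_le_sum (s := Finset.univ) fun k _ => hsucc k
    rw [Finset.sum_const, Finset.card_univ, nsmul_eq_mul, ← hK] at h3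
    nlinarith
  -- Fewer than `K/8` errors outside an event of probability below 1/4, and at most `K` on it, give
  -- an expectation below `K/8 + K/4`, against the average lower bound `3K/8`.
  have hup : ∀ θ, ∑ b, P θ b * hammingDist (ψ b) θ < 3 / 8 * K := by
    intro θ
    calc ∑ b, P θ b * hammingDist (ψ b) θ
        ≤ ∑ b, (K / 8 * P θ b +
            K * if K / 8 ≤ hammingDist (ψ b) θ then P θ b else 0) := by
          refine Finset.sum_le_sum fun b _ => ?_
          have hp := hP θ b
          have hle : (hammingDist (ψ b) θ : ℝ) ≤ K := by
            rw [hK]; exact_mod_cast hammingDist_le_card_fintype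
          split_ifs with h
          · nlinarith
          · push Not at h
            nlinarith
      _ = K / 8 + K * ∑ b, if K / 8 ≤ hammingDist (ψ b) θ then P θ b else 0 := by
          rw [Finset.sum_add_distrib, ← Finset.mul_sum, ← Finset.mul_sum, hP1, mul_one]
      _ < K / 8 + K * (1 / 4) := by gcongr; exact hcon θ
      _ = _ := by ring
  have : Nonempty (κ → A) := ⟨fun _ => a₀⟩
  have h4 := Finset.sum_lt_sum_of_nonempty (s := Finset.univ) Finset.univ_nonempty
    fun θ _ => hup θ
  rw [Finset.sum_const, Finset.card_univ, nsmul_eq_mul] at h4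
  nlinarith

end Assouad

/-! ### Likelihood and chi-square divergence of the network law; reduction to a cube -/

section NetworkLaw

/-- The mass that a Bernoulli variable with success probability `p` gives to `x`. -/
noncomputable def bernMass (p : ℝ) (x : Bool) : ℝ := if x then p else 1 - p

/-- The probability of a given observation. -/
noncomputable def networkMass {n L : ℕ} (Λ : Fin n → Fin n → Fin L → I) (b : Observation n L) : ℝ :=
  ∏ e : Edge n, ∏ l, bernMass (Λ e.1.1 e.1.2 l) (b e l)

lemma bernMass_nonneg (p : I) (x : Bool) : 0 ≤ bernMass p x := by
  unfold bernMass
  split_ifs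
  · exact p.2.1
  · linarith [p.2.2]

lemma networkMass_nonneg {n L : ℕ} (Λ : Fin n → Fin n → Fin L → I) (b : Observation n L) :
    0 ≤ networkMass Λ b :=
  Finset.prod_nonneg fun _ _ => Finset.prod_nonneg fun _ _ => bernMass_nonneg _ _

lemma bernoulliMeasure_singleton (p : I) (x : Bool) :
    ProbabilityTheory.bernoulliMeasure true false p {x} = ENNReal.ofReal (bernMass p x) := by
  rw [ProbabilityTheory.bernoulliMeasure_apply p (MeasurableSet.singleton x)]
  cases x
  · simp only [bernMass, Set.mem_singleton_iff, Bool.true_eq_false, if_false, if_true,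
      Bool.false_eq_true]
    rw [ENNReal.ofReal, Real.toNNReal_of_nonneg (by linarith [p.2.2])]
    rfl
  · simp only [bernMass, Set.mem_singleton_iff, if_true, if_false, Bool.false_eq_true]
    rw [ENNReal.ofReal, Real.toNNReal_of_nonneg p.2.1]
    rfl

lemma networkLaw_singleton {n L : ℕ} (Λ : Fin n → Fin n → Fin L → I) (b : Observation n L) :
    networkLaw Λ {b} = ENNReal.ofReal (networkMass Λ b) := by
  unfold networkLaw networkMass
  rw [Measure.pi_singleton, ENNReal.ofReal_prod_of_nonneg
    fun e _ => Finset.prod_nonneg fun _ _ => bernMass_nonneg _ _]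
  refine Finset.prod_congr rfl fun e _ => ?_
  rw [Measure.pi_singleton, ENNReal.ofReal_prod_of_nonneg fun _ _ => bernMass_nonneg _ _]
  exact Finset.prod_congr rfl fun l _ => bernoulliMeasure_singleton _ _

open Classical in
lemma networkLaw_setOf {n L : ℕ} (Λ : Fin n → Fin n → Fin L → I) (p : Observation n L → Prop) :
    networkLaw Λ {b | p b} = ENNReal.ofReal (∑ b, if p b then networkMass Λ b else 0) := by
  have h : {b | p b} = ((Finset.univ.filter p : Finset (Observation n L)) : Set _) := by
    ext; simp
  have : MeasurableSingletonClass (Edge n → Fin L → Bool) := inferInstance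
  rw [h, ← sum_measure_singleton, ← Finset.sum_filter,
    ENNReal.ofReal_sum_of_nonneg fun b _ => networkMass_nonneg Λ b]
  exact Finset.sum_congr rfl fun b _ => networkLaw_singleton Λ b

lemma sum_prod_prod {n L : ℕ} (g : Edge n → Fin L → Bool → ℝ) :
    ∑ b : Observation n L, ∏ e, ∏ l, g e l (b e l) = ∏ e, ∏ l, ∑ x, g e l x := by
  have h1 : ∀ e, ∏ l, ∑ x, g e l x = ∑ y : Fin L → Bool, ∏ l, g e l (y l) := by
    intro e
    rw [Finset.prod_univ_sum, Fintype.piFinset_univ]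
  simp only [h1]
  rw [Finset.prod_univ_sum, Fintype.piFinset_univ]

lemma sum_networkMass {n L : ℕ} (Λ : Fin n → Fin n → Fin L → I) : ∑ b, networkMass Λ b = 1 := by
  unfold networkMass
  rw [sum_prod_prod (fun e l x => bernMass (Λ e.1.1 e.1.2 l) x)]
  simp [bernMass]

lemma networkMass_pos {n L : ℕ} {Λ : Fin n → Fin n → Fin L → I}
    (h : ∀ e : Edge n, ∀ l, (Λ e.1.1 e.1.2 l : ℝ) ∈ Set.Icc (1 / 4) (3 / 4)) (b : Observation n L) :
    0 < networkMass Λ b := by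
  refine Finset.prod_pos fun e _ => Finset.prod_pos fun l _ => ?_
  have := h e l
  unfold bernMass
  split_ifs
  · linarith [this.1]
  · linarith [this.2]

/-- The chi-square divergence between two network laws with probabilities away from `0` and `1`. -/
lemma chiSq_networkMass_le {n L : ℕ} {Λ Λ' : Fin n → Fin n → Fin L → I}
    (h' : ∀ e : Edge n, ∀ l, (Λ' e.1.1 e.1.2 l : ℝ) ∈ Set.Icc (1 / 4) (3 / 4)) :
    ∑ b, (networkMass Λ b - networkMass Λ' b) ^ 2 / networkMass Λ' b ≤
      Real.exp (16 / 3 * ∑ e : Edge n, ∑ l, ((Λ e.1.1 e.1.2 l : ℝ) - Λ' e.1.1 e.1.2 l) ^ 2) - 1 := by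
  -- Expanding the square leaves `P²/Q - 2P + Q`; the first term factorizes over independent entries
  -- and the others sum to -1.
  have h1 : ∀ b, (networkMass Λ b - networkMass Λ' b) ^ 2 / networkMass Λ' b =
      (∏ e : Edge n, ∏ l, bernMass (Λ e.1.1 e.1.2 l) (b e l) ^ 2 /
        bernMass (Λ' e.1.1 e.1.2 l) (b e l)) - 2 * networkMass Λ b + networkMass Λ' b := by
    intro b
    have hpos := networkMass_pos h' b
    have : (∏ e : Edge n, ∏ l, bernMass (Λ e.1.1 e.1.2 l) (b e l) ^ 2 /
        bernMass (Λ' e.1.1 e.1.2 l) (b e l)) = networkMass Λ b ^ 2 / networkMass Λ' b := by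
      unfold networkMass
      simp only [Finset.prod_div_distrib, Finset.prod_pow]
    rw [this]
    field_simp
    ring
  simp only [h1, Finset.sum_add_distrib, Finset.sum_sub_distrib, ← Finset.mul_sum, sum_networkMass]
  rw [sum_prod_prod (fun e l x => bernMass (Λ e.1.1 e.1.2 l) x ^ 2 /
        bernMass (Λ' e.1.1 e.1.2 l) x), Finset.mul_sum]
  simp only [Finset.mul_sum]
  rw [Real.exp_sum]
  simp only [Real.exp_sum]
  have h2 : ∏ e : Edge n, ∏ l, ∑ x, bernMass (Λ e.1.1 e.1.2 l) x ^ 2 /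
        bernMass (Λ' e.1.1 e.1.2 l) x ≤ ∏ e : Edge n, ∏ l,
        Real.exp (16 / 3 * ((Λ e.1.1 e.1.2 l : ℝ) - Λ' e.1.1 e.1.2 l) ^ 2) := by
    have hnn : ∀ (e : Edge n) l, 0 ≤ ∑ x, bernMass (Λ e.1.1 e.1.2 l) x ^ 2 /
        bernMass (Λ' e.1.1 e.1.2 l) x := fun e l =>
      Finset.sum_nonneg fun x _ => div_nonneg (sq_nonneg _) (bernMass_nonneg _ _)
    refine Finset.prod_le_prod (fun e _ => Finset.prod_nonneg fun l _ => hnn e l) fun e _ =>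
      Finset.prod_le_prod (fun l _ => hnn e l) fun l _ => ?_
    obtain ⟨hl, hu⟩ := h' e l
    set q : ℝ := (Λ' e.1.1 e.1.2 l : ℝ)
    set p : ℝ := (Λ e.1.1 e.1.2 l : ℝ)
    have hq : 0 < q := by linarith
    have hq1 : 0 < 1 - q := by linarith
    -- For `q` in `[1/4, 3/4]` one has `q (1 - q) ≥ 3/16`, the origin of the constant 16/3.
    have heq : ∑ x, bernMass p x ^ 2 / bernMass q x = 1 + (p - q) ^ 2 / (q * (1 - q)) := by
      simp [bernMass]
      field_simp
      ring
    rw [heq]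
    have h3 : (p - q) ^ 2 / (q * (1 - q)) ≤ 16 / 3 * (p - q) ^ 2 := by
      rw [div_le_iff₀ (by positivity)]
      have : 3 / 16 ≤ q * (1 - q) := by nlinarith
      nlinarith [sq_nonneg (p - q)]
    linarith [Real.add_one_le_exp (16 / 3 * (p - q) ^ 2)]
  linarith

lemma sum_edge_le_sum {n : ℕ} (g : Fin n → Fin n → ℝ) (hg : ∀ i j, 0 ≤ g i j) :
    ∑ e : Edge n, g e.1.1 e.1.2 ≤ ∑ i, ∑ j, g i j := by
  rw [← Fintype.sum_prod_type' g]
  rw [← Finset.sum_subtype (Finset.univ.filter fun e : Fin n × Fin n => e.1 < e.2)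
    (by simp) (fun e : Fin n × Fin n => g e.1 e.2)]
  exact Finset.sum_le_sum_of_subset_of_nonneg (Finset.subset_univ _) fun _ _ _ => hg _ _

/-- A minimax lower bound from a cube of well separated, hardly distinguishable parameters. -/
theorem minimaxProb_ge_of_cube {n L : ℕ} (hn : 0 < n) (hL : 0 < L)
    {κ A : Type*} [Fintype κ] [DecidableEq κ] [Nonempty κ]
    [Fintype A] [DecidableEq A] (a₀ : A) (hA : 2 ≤ Fintype.card A)
    (𝓕 : Set (I → I → I → I)) (f : (κ → A) → I → I → I → I) (ζ : (κ → A) → Fin n → I)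
    (hf : ∀ θ, f θ ∈ 𝓕)
    (hp : ∀ θ i j (l : Fin L), i ≠ j → (f θ (ζ θ i) (ζ θ j) (time l) : ℝ) ∈ Set.Icc (1 / 4) (3 / 4))
    (hinfo : ∀ θ k, ∑ i, ∑ j, ∑ l : Fin L, ((probTensor (f θ) (ζ θ) i j l : ℝ) -
      probTensor (f (Function.update θ k a₀)) (ζ (Function.update θ k a₀)) i j l) ^ 2 ≤
        Real.log (Fintype.card A) / 342)
    (δ : ℝ) (hsep : ∀ θ θ', δ * hammingDist θ θ' ≤
      ∑ i, ∑ j, ∑ l : Fin L, ((probTensor (f θ) (ζ θ) i j l : ℝ) - probTensor (f θ') (ζ θ') i j l) ^ 2)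
    (hδ : 0 ≤ δ) (Δ : ℝ) (hΔ : Δ * ((n : ℝ) ^ 2 * L) ≤ δ * Fintype.card κ / 32) :
    1 / 4 ≤ minimaxProb n L 𝓕 Δ := by
  classical
  set Λ := fun θ => probTensor (L := L) (f θ) (ζ θ) with hΛ
  have hp' : ∀ θ, ∀ e : Edge n, ∀ l, (Λ θ e.1.1 e.1.2 l : ℝ) ∈ Set.Icc (1 / 4) (3 / 4) := by
    intro θ e l
    have hne : e.1.1 ≠ e.1.2 := e.2.ne
    simp only [hΛ, probTensor, if_neg hne]
    exact hp θ _ _ l hne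
  unfold minimaxProb
  refine le_iInf fun Λ' => ?_
  have : Nonempty (κ → A) := ⟨fun _ => a₀⟩
  set D : Observation n L → (κ → A) → ℝ := fun b θ =>
    ∑ i, ∑ j, ∑ l, (Λ' b i j l - (Λ θ i j l : ℝ)) ^ 2 with hD
  -- The decoder picks the cube point nearest to the estimate.
  have hmin : ∀ b, ∃ θ, ∀ θ', D b θ ≤ D b θ' := fun b => Finite.exists_min (D b)
  choose ψ hψ using hmin
  have hMpos : (2 : ℝ) ≤ Fintype.card A := by exact_mod_cast hA
  obtain ⟨θ, hθ⟩ := exists_hammingDist_prob_ge a₀ hA (fun θ => networkMass (Λ θ))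
    (fun θ b => networkMass_pos (hp' θ) b) (fun θ => sum_networkMass _) (fun θ k => by
      refine (chiSq_networkMass_le (hp' _)).trans ?_
      have h1 : ∑ e : Edge n, ∑ l, ((Λ θ e.1.1 e.1.2 l : ℝ) -
          Λ (Function.update θ k a₀) e.1.1 e.1.2 l) ^ 2 ≤ Real.log (Fintype.card A) / 342 :=
        (sum_edge_le_sum (fun i j => ∑ l, ((Λ θ i j l : ℝ) -
          Λ (Function.update θ k a₀) i j l) ^ 2)
          fun i j => Finset.sum_nonneg fun _ _ => sq_nonneg _).trans (hinfo θ k)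
      have hlog : 0 ≤ Real.log (Fintype.card A) := Real.log_nonneg (by linarith)
      -- The constant 342 makes `16/(3 · 342) ≤ 1/64`; Bernoulli's inequality then gives `M^(1/64) -
      -- 1 ≤ (M-1)/64`, so the budget grows like `log M`.
      have h2 : Real.exp (16 / 3 * ∑ e : Edge n, ∑ l, ((Λ θ e.1.1 e.1.2 l : ℝ) -
          Λ (Function.update θ k a₀) e.1.1 e.1.2 l) ^ 2) ≤
          Real.exp (Real.log (Fintype.card A) * (1 / 64)) := by
        apply Real.exp_le_exp.2; linarith
      rw [← Real.rpow_def_of_pos (by linarith)] at h2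
      have h3 := rpow_one_add_le_one_add_mul_self (s := (Fintype.card A : ℝ) - 1)
        (by linarith) (p := 1 / 64) (by norm_num) (by norm_num)
      rw [add_sub_cancel] at h3
      linarith) ψ
  refine le_trans ?_ (le_iSup₂_of_le (f θ) (hf θ) (le_iSup_of_le (ζ θ) le_rfl))
  rw [networkLaw_setOf]
  have h14 : (1 / 4 : ℝ≥0∞) = ENNReal.ofReal (1 / 4) := by
    rw [ENNReal.ofReal_div_of_pos (by norm_num)]; simp
  rw [h14]
  apply ENNReal.ofReal_le_ofReal
  refine hθ.trans (Finset.sum_le_sum fun b _ => ?_)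
  have hnn := networkMass_nonneg (Λ θ) b
  by_cases hb : (Fintype.card κ : ℝ) / 8 ≤ hammingDist (ψ b) θ
  swap
  · rw [if_neg hb]; split_ifs
    · exact hnn
    · exact le_rfl
  have hgoal : Δ ≤ normalizedError (Λ' b) (Λ θ) := by
    unfold normalizedError
    rw [le_div_iff₀ (by positivity)]
    have h5 := hsep (ψ b) θ
    -- As the decoded point is nearest, this is at most `4 D b θ`; together with the fraction 1/8 of
    -- wrong coordinates it gives the constant 32.
    have h6 : ∑ i, ∑ j, ∑ l, ((Λ (ψ b) i j l : ℝ) - Λ θ i j l) ^ 2 ≤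
        2 * D b (ψ b) + 2 * D b θ := by
      simp only [hD, Finset.mul_sum, ← Finset.sum_add_distrib]
      refine Finset.sum_le_sum fun i _ => Finset.sum_le_sum fun j _ =>
        Finset.sum_le_sum fun l _ => ?_
      nlinarith [sq_nonneg ((Λ' b i j l - (Λ (ψ b) i j l : ℝ)) + (Λ' b i j l - (Λ θ i j l : ℝ)))]
    have h7 := hψ b θ
    have h8 : δ * (Fintype.card κ / 8) ≤ δ * hammingDist (ψ b) θ := by gcongr
    have h9 : Δ * ((n : ℝ) ^ 2 * L) ≤ D b θ := by linarith
    exact h9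
  rw [if_pos hb, if_pos hgoal]

end NetworkLaw

end DynamicGraphon

namespace DynamicGraphon

/-! ### Graphons with prescribed transform coefficients -/

section Transform

open Matrix

variable {L : ℕ} {H : Matrix (Fin L) (Fin L) ℝ}

/-- Testing the condition on single basis vectors already bounds the entries; by linearity this
gives the l1 bound for all real vectors. -/
lemma TransformCondition.abs_le (hT : TransformCondition H) (l k : Fin L) :
    |H l k| ≤ 1 / √(L : ℝ) := by
  have h := hT.1 (Pi.single l 1) (fun m => by
    by_cases hm : m = l
    · subst hm; right; simp
    · left; simp [hm]) k
  have h1 : ∑ m, |(Pi.single l 1 : Fin L → ℝ) m| = 1 := by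
    rw [Finset.sum_eq_single l] <;> simp +contextual
  rw [h1, Matrix.mulVec_single_one] at h
  exact h

lemma TransformCondition.abs_transpose_mulVec_le (hT : TransformCondition H) (w : Fin L → ℝ)
    (k : Fin L) : |(Hᵀ *ᵥ w) k| ≤ (∑ l, |w l|) / √(L : ℝ) := by
  calc |(Hᵀ *ᵥ w) k| = |∑ l, H l k * w l| := rfl
    _ ≤ ∑ l, |H l k * w l| := Finset.abs_sum_le_sum_abs _ _
    _ ≤ ∑ l, 1 / √(L : ℝ) * |w l| := by
        refine Finset.sum_le_sum fun l _ => ?_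
        rw [abs_mul]
        exact mul_le_mul_of_nonneg_right (hT.abs_le l k) (abs_nonneg _)
    _ = _ := by rw [← Finset.mul_sum]; ring

lemma sum_sq_transpose_mulVec (hH : H ∈ Matrix.orthogonalGroup (Fin L) ℝ) (w : Fin L → ℝ) :
    ∑ k, (Hᵀ *ᵥ w) k ^ 2 = ∑ l, w l ^ 2 := by
  have h1 : H * Hᵀ = 1 := (Matrix.mem_orthogonalGroup_iff _ _).1 hH
  have h2 : (Hᵀ *ᵥ w) ⬝ᵥ (Hᵀ *ᵥ w) = w ⬝ᵥ w := by
    rw [Matrix.dotProduct_mulVec, Matrix.vecMul_transpose, Matrix.mulVec_mulVec, h1,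
      Matrix.one_mulVec]
  simpa [dotProduct, sq] using h2

lemma time_injective : Function.Injective (time : Fin L → I) := by
  intro l l' h
  have hL : (L : ℝ) ≠ 0 := by exact_mod_cast l.pos.ne'
  have h1 : ((l : ℝ) + 1) / L = ((l' : ℝ) + 1) / L := congrArg Subtype.val h
  field_simp at h1
  exact Fin.ext (by exact_mod_cast add_right_cancel h1)

/-- Tables of transform coefficients, small enough in the time direction and bounded by `g`, are
realized by a member of the class at suitable positions. -/
def Realizable (H : Matrix (Fin L) (Fin L) ℝ) (𝓕 : Set (I → I → I → I)) (h : ℕ) (ν₂ K₂ g : ℝ) :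
    Prop :=
  ∀ w : Fin h → Fin h → Fin L → ℝ, (∀ a b, w a b = w b a) →
    (∀ a b, ∑ l, |w a b l| ≤ √(L : ℝ) / 4) →
    (∀ a b, ∑ l : Fin L, (l : ℝ) ^ (2 * ν₂) * w a b l ^ 2 ≤ K₂) →
    (∀ a b l, |w a b l| ≤ g) →
    ∃ f ∈ 𝓕, ∃ x : Fin h → I, ∀ a b k,
      (f (x a) (x b) (time k) : ℝ) = 1 / 2 + (Hᵀ *ᵥ w a b) k

/-- The mixture of the vectors `w a b` with weights `φ a x * φ b y`. -/
def mixture {X : Type*} {h : ℕ} (φ : Fin h → X → ℝ) (w : Fin h → Fin h → Fin L → ℝ) (x y : X) :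
    Fin L → ℝ :=
  fun l => ∑ a, ∑ b, φ a x * φ b y * w a b l

/-- The dynamic graphon with mean `1 / 2` and transform coefficients given by a mixture. -/
noncomputable def mixtureGraphon (H : Matrix (Fin L) (Fin L) ℝ) {h : ℕ} (φ : Fin h → I → ℝ)
    (w : Fin h → Fin h → Fin L → ℝ) : I → I → I → I :=
  fun x y t => Function.extend time
    (fun k => Set.projIcc (0 : ℝ) 1 zero_le_one (1 / 2 + (Hᵀ *ᵥ mixture φ w x y) k))
    (fun _ => 0) t

variable {h : ℕ} {φ : Fin h → I → ℝ} {w : Fin h → Fin h → Fin L → ℝ}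

lemma mixture_symm {X : Type*} {φ : Fin h → X → ℝ} (hw : ∀ a b, w a b = w b a) (x y : X) :
    mixture φ w x y = mixture φ w y x := by
  ext l
  unfold mixture
  rw [Finset.sum_comm]
  refine Finset.sum_congr rfl fun a _ => Finset.sum_congr rfl fun b _ => ?_
  rw [hw b a]; ring

lemma sum_weights_le_one (hφ : ∀ a x, 0 ≤ φ a x) (hφ1 : ∀ x, ∑ a, φ a x ≤ 1) (x y : I) :
    ∑ a, ∑ b, φ a x * φ b y ≤ 1 := by
  rw [← Finset.sum_mul_sum]
  exact mul_le_one₀ (hφ1 x) (Finset.sum_nonneg fun a _ => hφ a y) (hφ1 y)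

lemma sum_abs_mixture_le (hφ : ∀ a x, 0 ≤ φ a x) (hφ1 : ∀ x, ∑ a, φ a x ≤ 1)
    {c : ℝ} (hc : 0 ≤ c) (hw : ∀ a b, ∑ l, |w a b l| ≤ c) (x y : I) :
    ∑ l, |mixture φ w x y l| ≤ c := by
  calc ∑ l, |mixture φ w x y l| ≤ ∑ l, ∑ a, ∑ b, φ a x * φ b y * |w a b l| := by
        refine Finset.sum_le_sum fun l _ => (Finset.abs_sum_le_sum_abs _ _).trans ?_
        refine Finset.sum_le_sum fun a _ => (Finset.abs_sum_le_sum_abs _ _).trans ?_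
        refine Finset.sum_le_sum fun b _ => ?_
        rw [abs_mul, abs_of_nonneg (mul_nonneg (hφ a x) (hφ b y))]
    _ = ∑ a, ∑ b, φ a x * φ b y * ∑ l, |w a b l| := by
        rw [Finset.sum_comm]
        refine Finset.sum_congr rfl fun a _ => ?_
        rw [Finset.sum_comm]
        simp only [Finset.mul_sum]
    _ ≤ ∑ a, ∑ b, φ a x * φ b y * c := by
        refine Finset.sum_le_sum fun a _ => Finset.sum_le_sum fun b _ => ?_
        exact mul_le_mul_of_nonneg_left (hw a b) (mul_nonneg (hφ a x) (hφ b y))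
    _ = (∑ a, ∑ b, φ a x * φ b y) * c := by simp only [Finset.sum_mul]
    _ ≤ 1 * c := by gcongr; exact sum_weights_le_one hφ hφ1 x y
    _ = c := one_mul c

/-- Cauchy–Schwarz for weights of total mass at most one: quadratic constraints on the table pass to
all mixtures. -/
lemma sq_mixture_le (hφ : ∀ a x, 0 ≤ φ a x) (hφ1 : ∀ x, ∑ a, φ a x ≤ 1) (x y : I) (l : Fin L) :
    mixture φ w x y l ^ 2 ≤ ∑ a, ∑ b, φ a x * φ b y * w a b l ^ 2 := by
  have hcs := Finset.sum_sq_le_sum_mul_sum_of_sq_le_mul (Finset.univ (α := Fin h × Fin h))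
    (r := fun p => φ p.1 x * φ p.2 y * w p.1 p.2 l) (f := fun p => φ p.1 x * φ p.2 y)
    (g := fun p => φ p.1 x * φ p.2 y * w p.1 p.2 l ^ 2)
    (fun p _ => mul_nonneg (hφ _ _) (hφ _ _))
    (fun p _ => mul_nonneg (mul_nonneg (hφ _ _) (hφ _ _)) (sq_nonneg _))
    (fun p _ => le_of_eq (by ring))
  simp only [Fintype.sum_prod_type] at hcs
  refine hcs.trans ?_
  refine mul_le_of_le_one_left ?_ (sum_weights_le_one hφ hφ1 x y)
  exact Finset.sum_nonneg fun a _ => Finset.sum_nonneg fun b _ =>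
    mul_nonneg (mul_nonneg (hφ _ _) (hφ _ _)) (sq_nonneg _)

lemma mixtureGraphon_symm (hw : ∀ a b, w a b = w b a) (x y t : I) :
    mixtureGraphon H φ w x y t = mixtureGraphon H φ w y x t := by
  unfold mixtureGraphon
  rw [mixture_symm hw]

/-- The l1 bound keeps the perturbation within 1/4, so the clamping to `[0, 1]` is inactive. -/
lemma mixtureGraphon_time (hT : TransformCondition H)
    (hφ : ∀ a x, 0 ≤ φ a x) (hφ1 : ∀ x, ∑ a, φ a x ≤ 1)
    (hw : ∀ a b, ∑ l, |w a b l| ≤ √(L : ℝ) / 4) (x y : I) (k : Fin L) :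
    (mixtureGraphon H φ w x y (time k) : ℝ) = 1 / 2 + (Hᵀ *ᵥ mixture φ w x y) k := by
  have hL : 0 < √(L : ℝ) := Real.sqrt_pos.2 (by exact_mod_cast k.pos)
  have h1 := hT.abs_transpose_mulVec_le (mixture φ w x y) k
  have h2 := sum_abs_mixture_le hφ hφ1 (by positivity) hw x y
  have h3 : |(Hᵀ *ᵥ mixture φ w x y) k| ≤ 1 / 4 :=
    h1.trans (by rw [div_le_iff₀ hL]; linarith)
  rw [abs_le] at h3
  unfold mixtureGraphon
  rw [time_injective.extend_apply, Set.projIcc_of_mem zero_le_one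
    ⟨by linarith [h3.1], by linarith [h3.2]⟩]

lemma coeff_mixtureGraphon (hH : H ∈ Matrix.orthogonalGroup (Fin L) ℝ) (hT : TransformCondition H)
    (hφ : ∀ a x, 0 ≤ φ a x) (hφ1 : ∀ x, ∑ a, φ a x ≤ 1)
    (hw : ∀ a b, ∑ l, |w a b l| ≤ √(L : ℝ) / 4) (l : Fin L) (x y : I) :
    coeff H (mixtureGraphon H φ w) l x y =
      (if (l : ℕ) = 0 then √(L : ℝ) / 2 else 0) + mixture φ w x y l := by
  unfold coeff
  simp only [mixtureGraphon_time hT hφ hφ1 hw]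
  have h0 : (fun k => 1 / 2 + (Hᵀ *ᵥ mixture φ w x y) k) =
      (1 / 2 : ℝ) • (fun _ => (1 : ℝ)) + Hᵀ *ᵥ mixture φ w x y := by
    ext k; simp
  rw [h0, Matrix.mulVec_add, Matrix.mulVec_smul, hT.2, Matrix.mulVec_mulVec,
    (Matrix.mem_orthogonalGroup_iff _ _).1 hH, Matrix.one_mulVec]
  simp only [Pi.add_apply, Pi.smul_apply, smul_eq_mul]
  split_ifs <;> ring

lemma timeSmooth_mixtureGraphon (hH : H ∈ Matrix.orthogonalGroup (Fin L) ℝ)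
    (hT : TransformCondition H) (hφ : ∀ a x, 0 ≤ φ a x) (hφ1 : ∀ x, ∑ a, φ a x ≤ 1)
    (hw : ∀ a b, ∑ l, |w a b l| ≤ √(L : ℝ) / 4) {ν₂ K₂ : ℝ} (hν₂ : 0 < ν₂) (hK₂ : 0 ≤ K₂)
    (hwK : ∀ a b, ∑ l : Fin L, (l : ℝ) ^ (2 * ν₂) * w a b l ^ 2 ≤ K₂) :
    TimeSmooth H ν₂ K₂ (mixtureGraphon H φ w) := by
  intro x y
  calc ∑ l : Fin L, (l : ℝ) ^ (2 * ν₂) * coeff H (mixtureGraphon H φ w) l x y ^ 2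
      ≤ ∑ l : Fin L, (l : ℝ) ^ (2 * ν₂) * ∑ a, ∑ b, φ a x * φ b y * w a b l ^ 2 := by
        refine Finset.sum_le_sum fun l _ => ?_
        rw [coeff_mixtureGraphon hH hT hφ hφ1 hw]
        -- The mean 1/2 contributes only to the coefficient of index zero, whose weight `0^(2ν₂)`
        -- vanishes.
        by_cases hl : (l : ℕ) = 0
        · rw [hl, Nat.cast_zero, Real.zero_rpow (by positivity)]; simp
        · rw [if_neg hl, zero_add]
          exact mul_le_mul_of_nonneg_left (sq_mixture_le hφ hφ1 x y l) (by positivity)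
    _ = ∑ a, ∑ b, φ a x * φ b y * ∑ l : Fin L, (l : ℝ) ^ (2 * ν₂) * w a b l ^ 2 := by
        simp only [Finset.mul_sum]
        rw [Finset.sum_comm]
        refine Finset.sum_congr rfl fun a _ => ?_
        rw [Finset.sum_comm]
        refine Finset.sum_congr rfl fun b _ => Finset.sum_congr rfl fun l _ => ?_
        ring
    _ ≤ ∑ a, ∑ b, φ a x * φ b y * K₂ := by
        refine Finset.sum_le_sum fun a _ => Finset.sum_le_sum fun b _ => ?_
        exact mul_le_mul_of_nonneg_left (hwK a b) (mul_nonneg (hφ a x) (hφ b y))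
    _ = (∑ a, ∑ b, φ a x * φ b y) * K₂ := by simp only [Finset.sum_mul]
    _ ≤ 1 * K₂ := by gcongr; exact sum_weights_le_one hφ hφ1 x y
    _ = K₂ := one_mul _

lemma mixture_at_node {X : Type*} {φ : Fin h → X → ℝ} {x : Fin h → X}
    (hx : ∀ a b, φ b (x a) = if b = a then 1 else 0) (a b : Fin h) :
    mixture φ w (x a) (x b) = w a b := by
  ext l
  simp [mixture, hx]

end Transform

/-! ### Realization in the piecewise constant class -/

section PiecewiseConstant

/-- The (zero-based) index of the piece of the uniform partition into `r` pieces. -/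
noncomputable def pieceIndex (r : ℕ) (x : I) : ℕ := ⌈(r : ℝ) * x⌉₊ - 1

/-- The uniform partition of the unit interval. -/
noncomputable def uniformPartition (r : ℕ) (i : Fin (r + 1)) : ℝ := (i : ℝ) / r

lemma isPartition_uniformPartition {r : ℕ} (hr : 0 < r) : IsPartition (uniformPartition r) := by
  have hr' : (0 : ℝ) < r := by exact_mod_cast hr
  refine ⟨by simp [uniformPartition], by simp [uniformPartition, hr'.ne'], fun i j hij => ?_⟩
  unfold uniformPartition
  gcongr
  exact_mod_cast hij

lemma pieceIndex_of_mem {r : ℕ} {i : Fin r} {x : I}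
    (hx : (x : ℝ) ∈ piece (uniformPartition r) i) : pieceIndex r x = i := by
  have hr : (0 : ℝ) < r := by exact_mod_cast i.pos
  obtain ⟨h1, h2⟩ := hx
  simp only [uniformPartition, Fin.val_castSucc, Fin.val_succ] at h1 h2
  rw [le_div_iff₀ hr] at h2
  have hle : ⌈(r : ℝ) * x⌉₊ ≤ (i : ℕ) + 1 := by
    apply Nat.ceil_le.2
    rw [mul_comm]
    exact h2
  -- Truncated subtraction sends `x = 0` to index 0, in agreement with the closed left end of the
  -- first piece.
  unfold pieceIndex
  rcases h1 with h1 | ⟨hi, -⟩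
  · rw [div_lt_iff₀ hr] at h1
    have : (i : ℕ) < ⌈(r : ℝ) * x⌉₊ := Nat.lt_ceil.2 (by rw [mul_comm]; exact h1)
    omega
  · omega

/-- The weights are indicators of the first `h` of `r` uniform pieces, and node `a` sits at the
right end of its piece. No amplitude bound is needed, so `g` is arbitrary. -/
theorem realizable_constClass {L : ℕ} {H : Matrix (Fin L) (Fin L) ℝ}
    (hH : H ∈ Matrix.orthogonalGroup (Fin L) ℝ) (hT : TransformCondition H) {h r : ℕ} (hr : 0 < r)
    (hhr : h ≤ r) {ν₂ K₂ : ℝ} (hν₂ : 0 < ν₂) (hK₂ : 0 ≤ K₂) (g : ℝ) :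
    Realizable H (constClass H r ν₂ K₂) h ν₂ K₂ g := by
  intro w hw hw1 hwK _
  have hr' : (0 : ℝ) < r := by exact_mod_cast hr
  set φ : Fin h → I → ℝ := fun a x => if pieceIndex r x = a then 1 else 0 with hφd
  have hφ : ∀ a x, 0 ≤ φ a x := by
    intro a x; simp only [hφd]; split_ifs <;> norm_num
  have hφ1 : ∀ x, ∑ a, φ a x ≤ 1 := by
    intro x
    simp only [hφd, Finset.sum_boole]
    have : (Finset.univ.filter fun a : Fin h => pieceIndex r x = a).card ≤ 1 :=
      Finset.card_le_one.2 fun a ha b hb => by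
        simp only [Finset.mem_filter, Finset.mem_univ, true_and] at ha hb
        exact Fin.ext (by omega)
    exact_mod_cast this
  have hxm : ∀ a : Fin h, ((a : ℝ) + 1) / r ∈ I := by
    intro a
    refine ⟨by positivity, (div_le_one hr').2 ?_⟩
    have : (a : ℕ) + 1 ≤ r := by omega
    exact_mod_cast this
  refine ⟨mixtureGraphon H φ w, ⟨mixtureGraphon_symm hw, ⟨uniformPartition r,
    isPartition_uniformPartition hr, ?_⟩, timeSmooth_mixtureGraphon hH hT hφ hφ1 hw1 hν₂ hK₂ hwK⟩,
    fun a => ⟨_, hxm a⟩, ?_⟩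
  · intro l i j x x' y y' hx hx' hy hy'
    rw [coeff_mixtureGraphon hH hT hφ hφ1 hw1, coeff_mixtureGraphon hH hT hφ hφ1 hw1]
    simp only [mixture, hφd, pieceIndex_of_mem hx,
      pieceIndex_of_mem hx', pieceIndex_of_mem hy, pieceIndex_of_mem hy']
  · intro a b k
    rw [mixtureGraphon_time hT hφ hφ1 hw1]
    congr 2
    have := mixture_at_node (w := w) (φ := φ) (x := fun a => ⟨_, hxm a⟩) (fun a b => by
      have h1 : pieceIndex r ⟨_, hxm a⟩ = a := by
        unfold pieceIndex
        simp only
        rw [mul_div_cancel₀ _ hr'.ne']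
        have : ⌈((a : ℕ) : ℝ) + 1⌉₊ = (a : ℕ) + 1 := by
          exact_mod_cast Nat.ceil_natCast (R := ℝ) ((a : ℕ) + 1)
        omega
      simp only [hφd, h1]
      congr 1
      simp [Fin.ext_iff, eq_comm]) a b
    rw [this]

end PiecewiseConstant

end DynamicGraphon

namespace DynamicGraphon

/-! ### Bump functions and realization in the Hölder class -/

section PiecewiseSmooth

/-- A smooth bump on the line, equal to one at the origin and supported in `[-1/4, 1/4]`. -/
noncomputable def lineBump : ContDiffBump (0 : ℝ) := ⟨1 / 8, 1 / 4, by norm_num, by norm_num⟩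

lemma lineBump_zero : lineBump 0 = 1 :=
  lineBump.one_of_mem_closedBall (Metric.mem_closedBall_self (by norm_num [lineBump]))

lemma lineBump_eq_zero {t : ℝ} (ht : 1 / 4 < |t|) : lineBump t = 0 := by
  apply lineBump.zero_of_le_dist
  rw [Real.dist_eq, sub_zero]
  exact ht.le

/-- A smooth bump on the plane, supported in a square of side `1 / 2`. -/
noncomputable def planeBump (z : ℝ × ℝ) : ℝ := lineBump z.1 * lineBump z.2

lemma contDiff_planeBump {n : WithTop ℕ∞} (hn : n ≤ (⊤ : ℕ∞)) : ContDiff ℝ n planeBump := by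
  have h : ContDiff ℝ n lineBump := lineBump.contDiff.of_le hn
  exact (h.comp contDiff_fst).mul (h.comp contDiff_snd)

lemma tsupport_planeBump_subset : tsupport planeBump ⊆ Metric.closedBall 0 (1 / 4) := by
  refine closure_minimal (fun z hz => ?_) Metric.isClosed_closedBall
  rw [mem_closedBall_zero_iff, Prod.norm_def, sup_le_iff, Real.norm_eq_abs, Real.norm_eq_abs]
  by_contra hcon
  apply hz
  rw [not_and_or, not_le, not_le] at hcon
  rcases hcon with h | h
  · simp [planeBump, lineBump_eq_zero h]
  · simp [planeBump, lineBump_eq_zero h]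

lemma hasCompactSupport_planeBump : HasCompactSupport planeBump :=
  (isCompact_closedBall 0 (1 / 4)).of_isClosed_subset (isClosed_tsupport _)
    tsupport_planeBump_subset

/-- The iterated derivatives of the bump are Hölder continuous of every order at most one. -/
lemma exists_holder_iteratedFDeriv_planeBump (m : ℕ) {α : ℝ} (hα : 0 < α) (hα1 : α ≤ 1) :
    ∃ C : ℝ, 0 < C ∧ ∀ u u' : ℝ × ℝ,
      ‖iteratedFDeriv ℝ m planeBump u - iteratedFDeriv ℝ m planeBump u'‖ ≤ C * ‖u - u'‖ ^ α := by
  have hsm : ContDiff ℝ 1 (iteratedFDeriv ℝ m planeBump) :=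
    (contDiff_planeBump (n := (⊤ : ℕ∞)) le_rfl).iteratedFDeriv_right (by exact_mod_cast le_top)
  have hcs : HasCompactSupport (iteratedFDeriv ℝ m planeBump) :=
    hasCompactSupport_planeBump.iteratedFDeriv m
  obtain ⟨K, hK⟩ := hsm.lipschitzWith_of_hasCompactSupport hcs one_ne_zero
  obtain ⟨B, hB⟩ := hcs.exists_bound_of_continuous hsm.continuous
  have hB0 : 0 ≤ B := (norm_nonneg _).trans (hB 0)
  -- The Lipschitz constant serves distances up to one, where `t ≤ t^α`; twice the sup bound serves
  -- larger ones.
  refine ⟨K + 2 * B + 1, by positivity, fun u u' => ?_⟩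
  have h0 := norm_nonneg (u - u')
  rcases le_or_gt ‖u - u'‖ 1 with h1 | h1
  · have h2 := hK.norm_sub_le u u'
    have h3 : ‖u - u'‖ ≤ ‖u - u'‖ ^ α := by
      simpa using Real.rpow_le_rpow_of_exponent_ge_of_imp h0 h1 hα1 (fun _ h => absurd h one_ne_zero)
    have h4 : (K : ℝ) * ‖u - u'‖ ≤ K * ‖u - u'‖ ^ α := by gcongr
    nlinarith [Real.rpow_nonneg h0 α]
  · have h2 := norm_sub_le (iteratedFDeriv ℝ m planeBump u) (iteratedFDeriv ℝ m planeBump u')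
    have h3 : 1 ≤ ‖u - u'‖ ^ α := Real.one_le_rpow h1.le hα.le
    have h4 : (K + 2 * B + 1) * 1 ≤ (K + 2 * B + 1) * ‖u - u'‖ ^ α := by gcongr
    linarith [hB u, hB u', K.coe_nonneg]

/-- The centre of a cell of the `h × h` grid, in units of the mesh size. -/
noncomputable def cellCentre {h : ℕ} (p : Fin h × Fin h) : ℝ × ℝ := (p.1 + 1 / 2, p.2 + 1 / 2)

/-- A function with one bump in each cell of the `h × h` grid. -/
noncomputable def bumpSum {h : ℕ} (u : Fin h × Fin h → ℝ) (z : ℝ × ℝ) : ℝ :=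
  ∑ p, u p * planeBump ((h : ℝ) • z - cellCentre p)

lemma contDiff_bump_cell {h : ℕ} (p : Fin h × Fin h) (n : ℕ) :
    ContDiff ℝ n fun z : ℝ × ℝ => planeBump ((h : ℝ) • z - cellCentre p) :=
  (contDiff_planeBump (by exact_mod_cast le_top)).comp
    ((contDiff_id.const_smul (h : ℝ)).sub contDiff_const)

lemma contDiff_bumpSum {h : ℕ} (u : Fin h × Fin h → ℝ) (n : ℕ) : ContDiff ℝ n (bumpSum u) :=
  ContDiff.sum fun p _ => contDiff_const.mul (contDiff_bump_cell p n)

lemma iteratedFDeriv_bumpSum {h : ℕ} (u : Fin h × Fin h → ℝ) (m : ℕ) (z : ℝ × ℝ) :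
    iteratedFDeriv ℝ m (bumpSum u) z = ∑ p, u p • (h : ℝ) ^ m •
      iteratedFDeriv ℝ m planeBump ((h : ℝ) • z - cellCentre p) := by
  have h1 : ∀ p : Fin h × Fin h, ContDiff ℝ m fun z => u p • planeBump ((h : ℝ) • z - cellCentre p) :=
    fun p => contDiff_const.fun_smul (contDiff_bump_cell p m)
  have h2 : bumpSum u = fun z => ∑ p, u p • planeBump ((h : ℝ) • z - cellCentre p) := rfl
  rw [h2, iteratedFDeriv_fun_sum_apply fun p _ => (h1 p).contDiffAt]
  refine Finset.sum_congr rfl fun p _ => ?_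
  rw [iteratedFDeriv_const_smul_apply' (contDiff_bump_cell p m).contDiffAt]
  congr 1
  have h3 : ContDiff ℝ m fun z : ℝ × ℝ => planeBump (z - cellCentre p) :=
    (contDiff_planeBump (by exact_mod_cast le_top)).comp (contDiff_id.sub contDiff_const)
  have h4 := congrFun (iteratedFDeriv_comp_const_smul (h : ℝ) h3) z
  rw [h4, iteratedFDeriv_comp_sub]

open Classical in
lemma sum_active_cell_le_one {h : ℕ} (z : ℝ × ℝ) :
    ∑ p : Fin h × Fin h, (if ‖(h : ℝ) • z - cellCentre p‖ ≤ 1 / 4 then (1 : ℝ) else 0) ≤ 1 := by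
  rw [Finset.sum_boole]
  have aux : ∀ (t : ℝ) (a b : Fin h), |t - ((a : ℝ) + 1 / 2)| ≤ 1 / 4 →
      |t - ((b : ℝ) + 1 / 2)| ≤ 1 / 4 → a = b := by
    intro t a b ha hb
    rw [abs_le] at ha hb
    have h1 : (a : ℝ) < b + 1 := by linarith
    have h2 : (b : ℝ) < a + 1 := by linarith
    have h1' : (a : ℕ) < b + 1 := by exact_mod_cast h1
    have h2' : (b : ℕ) < a + 1 := by exact_mod_cast h2
    exact Fin.ext (by omega)
  have : (Finset.univ.filter fun p : Fin h × Fin h =>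
      ‖(h : ℝ) • z - cellCentre p‖ ≤ 1 / 4).card ≤ 1 := by
    refine Finset.card_le_one.2 fun p hp q hq => ?_
    simp only [Finset.mem_filter, Finset.mem_univ, true_and, Prod.norm_def, sup_le_iff,
      Real.norm_eq_abs, cellCentre, Prod.fst_sub, Prod.snd_sub, Prod.smul_fst, Prod.smul_snd,
      smul_eq_mul] at hp hq
    exact Prod.ext (aux _ _ _ hp.1 hq.1) (aux _ _ _ hp.2 hq.2)
  exact_mod_cast this

/-- The supports are disjoint, so at most one cell is active at each of the two points: the loss is
a factor 2, independent of the number of cells. The power `h^m` comes from the chain rule. -/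
lemma norm_iteratedFDeriv_bumpSum_sub_le {h : ℕ} {u : Fin h × Fin h → ℝ} {g : ℝ}
    (hu : ∀ p, |u p| ≤ g) (hg : 0 ≤ g) {m : ℕ} {α C : ℝ} (hC : 0 ≤ C)
    (hbump : ∀ v v' : ℝ × ℝ,
      ‖iteratedFDeriv ℝ m planeBump v - iteratedFDeriv ℝ m planeBump v'‖ ≤ C * ‖v - v'‖ ^ α)
    (z z' : ℝ × ℝ) :
    ‖iteratedFDeriv ℝ m (bumpSum u) z - iteratedFDeriv ℝ m (bumpSum u) z'‖ ≤
      2 * (g * (h : ℝ) ^ m * (C * ((h : ℝ) * ‖z - z'‖) ^ α)) := by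
  classical
  set R := g * (h : ℝ) ^ m * (C * ((h : ℝ) * ‖z - z'‖) ^ α) with hR
  have hR0 : 0 ≤ R := by positivity
  have hzero : ∀ v : ℝ × ℝ, ¬ ‖v‖ ≤ 1 / 4 → iteratedFDeriv ℝ m planeBump v = 0 := by
    intro v hv
    by_contra hne
    apply hv
    have := tsupport_planeBump_subset (support_iteratedFDeriv_subset (𝕜 := ℝ) m hne)
    rwa [mem_closedBall_zero_iff] at this
  rw [iteratedFDeriv_bumpSum, iteratedFDeriv_bumpSum, ← Finset.sum_sub_distrib]
  refine (norm_sum_le _ _).trans ?_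
  have hterm : ∀ p : Fin h × Fin h,
      ‖u p • (h : ℝ) ^ m • iteratedFDeriv ℝ m planeBump ((h : ℝ) • z - cellCentre p) -
        u p • (h : ℝ) ^ m • iteratedFDeriv ℝ m planeBump ((h : ℝ) • z' - cellCentre p)‖ ≤
      R * (if ‖(h : ℝ) • z - cellCentre p‖ ≤ 1 / 4 then (1 : ℝ) else 0) +
        R * (if ‖(h : ℝ) • z' - cellCentre p‖ ≤ 1 / 4 then (1 : ℝ) else 0) := by
    intro p
    have hle : ‖u p • (h : ℝ) ^ m • iteratedFDeriv ℝ m planeBump ((h : ℝ) • z - cellCentre p) -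
        u p • (h : ℝ) ^ m • iteratedFDeriv ℝ m planeBump ((h : ℝ) • z' - cellCentre p)‖ ≤ R := by
      rw [← smul_sub, ← smul_sub, norm_smul, norm_smul, Real.norm_eq_abs, norm_pow,
        Real.norm_natCast, hR, ← mul_assoc]
      have h1 := hbump ((h : ℝ) • z - cellCentre p) ((h : ℝ) • z' - cellCentre p)
      rw [sub_sub_sub_cancel_right, ← smul_sub, norm_smul, Real.norm_natCast] at h1
      gcongr
      exact hu p
    split_ifs with h1 h2 h2
    · linarith
    · linarith
    · linarith
    · rw [hzero _ h1, hzero _ h2]; simp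
  refine (Finset.sum_le_sum fun p _ => hterm p).trans ?_
  rw [Finset.sum_add_distrib, ← Finset.mul_sum, ← Finset.mul_sum]
  have h1 := mul_le_mul_of_nonneg_left (sum_active_cell_le_one (h := h) z) hR0
  have h2 := mul_le_mul_of_nonneg_left (sum_active_cell_le_one (h := h) z') hR0
  linarith

lemma iteratedFDeriv_const_eq {E F : Type*} [NormedAddCommGroup E] [NormedSpace ℝ E]
    [NormedAddCommGroup F] [NormedSpace ℝ F] (m : ℕ) (c : F) (z z' : E) :
    iteratedFDeriv ℝ m (fun _ : E => c) z = iteratedFDeriv ℝ m (fun _ : E => c) z' := by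
  cases m with
  | zero => ext; simp
  | succ m => rw [iteratedFDeriv_succ_const]; rfl

lemma uniqueDiffOn_piece {r : ℕ} (β : Fin (r + 1) → ℝ) (hβ : StrictMono β) (i : Fin r) :
    UniqueDiffOn ℝ (piece β i) := by
  have hlt : β i.castSucc < β i.succ := hβ i.castSucc_lt_succ
  by_cases hi : (i : ℕ) = 0
  · have : piece β i = Set.Icc (β i.castSucc) (β i.succ) := by
      ext x
      simp only [piece, hi, true_and, Set.mem_ofPred_eq, Set.mem_Icc, le_iff_lt_or_eq (a := β i.castSucc),
        eq_comm (a := x)]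
    rw [this]
    exact uniqueDiffOn_Icc hlt
  · have : piece β i = Set.Ioc (β i.castSucc) (β i.succ) := by
      ext x
      simp [piece, hi]
    rw [this]
    exact uniqueDiffOn_Ioc _ _

lemma piece_subset_unitInterval {r : ℕ} {β : Fin (r + 1) → ℝ} (hβ : IsPartition β) (i : Fin r) :
    piece β i ⊆ I := by
  obtain ⟨h0, h1, hmono⟩ := hβ
  rintro x ⟨hx, hx'⟩
  have hl : 0 ≤ β i.castSucc := h0 ▸ hmono.monotone (Fin.zero_le _)
  have hu : β i.succ ≤ 1 := h1 ▸ hmono.monotone (Fin.le_last _)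
  refine ⟨?_, hx'.trans hu⟩
  rcases hx with h | ⟨-, h⟩ <;> linarith

lemma holderOrder_cast {ν : ℝ} (hν : 0 < ν) :
    0 < ν - holderOrder ν ∧ ν - holderOrder ν ≤ 1 := by
  have h1 : 0 < ⌈ν⌉₊ := Nat.ceil_pos.2 hν
  have h2 := Nat.ceil_lt_add_one hν.le
  have h3 := Nat.le_ceil ν
  have h4 : ((holderOrder ν : ℕ) : ℝ) = ⌈ν⌉₊ - 1 := by
    rw [holderOrder, Nat.cast_sub h1, Nat.cast_one]
  constructor <;> linarith

/-- The bump of the `a`-th of `h` cells of the unit interval. -/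
noncomputable def cellBump {h : ℕ} (a : Fin h) (x : I) : ℝ := lineBump ((h : ℝ) * x - (a + 1 / 2))

lemma sum_cellBump_le_one {h : ℕ} (x : I) : ∑ a : Fin h, cellBump a x ≤ 1 := by
  classical
  have hle : ∀ a : Fin h, cellBump a x ≤
      if |(h : ℝ) * x - ((a : ℝ) + 1 / 2)| ≤ 1 / 4 then (1 : ℝ) else 0 := by
    intro a
    split_ifs with ha
    · exact lineBump.le_one
    · exact (lineBump_eq_zero (not_le.1 ha)).le
  refine (Finset.sum_le_sum fun a _ => hle a).trans ?_
  rw [Finset.sum_boole]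
  have : (Finset.univ.filter fun a : Fin h =>
      |(h : ℝ) * x - ((a : ℝ) + 1 / 2)| ≤ 1 / 4).card ≤ 1 := by
    refine Finset.card_le_one.2 fun a ha b hb => ?_
    simp only [Finset.mem_filter, Finset.mem_univ, true_and] at ha hb
    rw [abs_le] at ha hb
    have h1 : (a : ℝ) < b + 1 := by linarith
    have h2 : (b : ℝ) < a + 1 := by linarith
    have h1' : (a : ℕ) < b + 1 := by exact_mod_cast h1
    have h2' : (b : ℕ) < a + 1 := by exact_mod_cast h2
    exact Fin.ext (by omega)
  exact_mod_cast this

/-- Rescaling to mesh `1/h` multiplies the Hölder seminorm of order `ν₁` by `h^ν₁`, which the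
amplitude `h^(-ν₁)` cancels. The bumps are smooth across the pieces, so the number `r` of pieces
plays no role. -/
theorem exists_realizable_smoothClass {ν₁ K₁ : ℝ} (hν₁ : 0 < ν₁) (hK₁ : 0 < K₁) :
    ∃ c : ℝ, 0 < c ∧ ∀ {L : ℕ} {H : Matrix (Fin L) (Fin L) ℝ},
      H ∈ Matrix.orthogonalGroup (Fin L) ℝ → TransformCondition H →
      ∀ {h r : ℕ}, 0 < h → 0 < r → ∀ {ν₂ K₂ : ℝ}, 0 < ν₂ → 0 ≤ K₂ →
        Realizable H (smoothClass H r ν₁ ν₂ K₁ K₂) h ν₂ K₂ (c * (h : ℝ) ^ (-ν₁)) := by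
  obtain ⟨hα, hα1⟩ := holderOrder_cast hν₁
  set m := holderOrder ν₁ with hm
  set α := ν₁ - m with hαd
  obtain ⟨C, hC, hbump⟩ := exists_holder_iteratedFDeriv_planeBump m hα hα1
  refine ⟨√K₁ / (2 * C), by positivity, ?_⟩
  intro L H hH hT h r hh hr ν₂ K₂ hν₂ hK₂ w hw hw1 hwK hwg
  have hh' : (0 : ℝ) < h := by exact_mod_cast hh
  have hφ : ∀ (a : Fin h) (x : I), 0 ≤ cellBump a x := fun a x => lineBump.nonneg
  have hφ1 : ∀ x : I, ∑ a : Fin h, cellBump a x ≤ 1 := sum_cellBump_le_one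
  have hxm : ∀ a : Fin h, ((a : ℝ) + 1 / 2) / h ∈ I := by
    intro a
    refine ⟨by positivity, (div_le_one hh').2 ?_⟩
    have : (a : ℕ) + 1 ≤ h := a.isLt
    have : (a : ℝ) + 1 ≤ h := by exact_mod_cast this
    linarith
  refine ⟨mixtureGraphon H cellBump w, ⟨mixtureGraphon_symm hw, ⟨uniformPartition r,
    isPartition_uniformPartition hr, ?_⟩, timeSmooth_mixtureGraphon hH hT hφ hφ1 hw1 hν₂ hK₂ hwK⟩,
    fun a => ⟨_, hxm a⟩, ?_⟩
  · intro l i j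
    have hpart := isPartition_uniformPartition hr
    set S := piece (uniformPartition r) i ×ˢ piece (uniformPartition r) j with hS
    -- Unique differentiability identifies derivatives within the rectangle with those of `V`, which
    -- is smooth on the whole plane.
    have hSu : UniqueDiffOn ℝ S :=
      (uniqueDiffOn_piece _ hpart.2.2 i).prod (uniqueDiffOn_piece _ hpart.2.2 j)
    set c₀ : ℝ := if (l : ℕ) = 0 then √(L : ℝ) / 2 else 0 with hc₀
    set V : ℝ × ℝ → ℝ := fun z => c₀ + bumpSum (fun p => w p.1 p.2 l) z with hV
    have hVs : ContDiff ℝ m V := contDiff_const.add (contDiff_bumpSum _ m)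
    have heq : Set.EqOn (coeffPlane H (mixtureGraphon H cellBump w) l) V S := by
      rintro ⟨x, y⟩ ⟨hx, hy⟩
      have hx' := piece_subset_unitInterval hpart i hx
      have hy' := piece_subset_unitInterval hpart j hy
      simp only [coeffPlane]
      rw [coeff_mixtureGraphon hH hT hφ hφ1 hw1, Set.projIcc_of_mem zero_le_one hx',
        Set.projIcc_of_mem zero_le_one hy']
      simp only [hV, hc₀, mixture, bumpSum, Fintype.sum_prod_type, cellBump, planeBump, cellCentre,
        Prod.fst_sub, Prod.snd_sub, Prod.smul_fst, Prod.smul_snd, smul_eq_mul]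
      congr 1
      exact Finset.sum_congr rfl fun a _ => Finset.sum_congr rfl fun b _ => mul_comm _ _
    rw [← hm]
    refine ⟨hVs.contDiffOn.congr heq, ?_⟩
    intro z hz z' hz' s
    rw [iteratedFDerivWithin_congr heq hz, iteratedFDerivWithin_congr heq hz',
      iteratedFDerivWithin_eq_iteratedFDeriv hSu hVs.contDiffAt hz,
      iteratedFDerivWithin_eq_iteratedFDeriv hSu hVs.contDiffAt hz',
      ← _root_.sub_apply]
    have hsub : iteratedFDeriv ℝ m V z - iteratedFDeriv ℝ m V z' =
        iteratedFDeriv ℝ m (bumpSum fun p => w p.1 p.2 l) z -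
          iteratedFDeriv ℝ m (bumpSum fun p => w p.1 p.2 l) z' := by
      have h1 : ∀ y, iteratedFDeriv ℝ m V y = iteratedFDeriv ℝ m (fun _ => c₀) y +
          iteratedFDeriv ℝ m (bumpSum fun p => w p.1 p.2 l) y := fun y =>
        fun_iteratedFDeriv_add_apply contDiff_const.contDiffAt
          (contDiff_bumpSum _ m).contDiffAt
      rw [h1, h1, iteratedFDeriv_const_eq m c₀ z z', add_sub_add_left_eq_sub]
    have hdir : ∏ k, ‖direction (s k)‖ ≤ 1 := by
      refine Finset.prod_le_one (fun _ _ => norm_nonneg _) fun k _ => ?_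
      unfold direction
      split_ifs <;> simp [Prod.norm_def]
    have hg0 : 0 ≤ √K₁ / (2 * C) * (h : ℝ) ^ (-ν₁) := by positivity
    have hnorm := norm_iteratedFDeriv_bumpSum_sub_le (u := fun p : Fin h × Fin h => w p.1 p.2 l)
      (fun p => hwg p.1 p.2 l) hg0 hC.le hbump z z'
    have hcalc : 2 * (√K₁ / (2 * C) * (h : ℝ) ^ (-ν₁) * (h : ℝ) ^ m *
        (C * ((h : ℝ) * ‖z - z'‖) ^ α)) = √K₁ * ‖z - z'‖ ^ α := by
      rw [Real.mul_rpow hh'.le (norm_nonneg _)]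
      have h1 : (h : ℝ) ^ (-ν₁) * (h : ℝ) ^ m * (h : ℝ) ^ α = 1 := by
        rw [← Real.rpow_natCast, ← Real.rpow_add hh', ← Real.rpow_add hh']
        rw [show -ν₁ + (m : ℝ) + α = 0 by rw [hαd]; ring, Real.rpow_zero]
      calc _ = √K₁ * ‖z - z'‖ ^ α * ((h : ℝ) ^ (-ν₁) * (h : ℝ) ^ m * (h : ℝ) ^ α) := by
            field_simp
        _ = _ := by rw [h1, mul_one]
    have hzz : ‖z - z'‖ ≤ |z.1 - z'.1| + |z.2 - z'.2| := by
      rw [Prod.norm_def, sup_le_iff]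
      constructor
      · simp
      · simp
    have hfin : |(iteratedFDeriv ℝ m V z - iteratedFDeriv ℝ m V z') fun k => direction (s k)| ≤
        √K₁ * (|z.1 - z'.1| + |z.2 - z'.2|) ^ α := by
      rw [← Real.norm_eq_abs]
      calc _ ≤ ‖iteratedFDeriv ℝ m V z - iteratedFDeriv ℝ m V z'‖ * ∏ k, ‖direction (s k)‖ :=
            ContinuousMultilinearMap.le_opNorm _ _
        _ ≤ ‖iteratedFDeriv ℝ m V z - iteratedFDeriv ℝ m V z'‖ * 1 := by gcongr
        _ ≤ √K₁ * ‖z - z'‖ ^ α := by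
            rw [mul_one, hsub]
            exact hnorm.trans_eq hcalc
        _ ≤ _ := by gcongr
    rw [← sq_abs]
    calc _ ≤ (√K₁ * (|z.1 - z'.1| + |z.2 - z'.2|) ^ α) ^ 2 := by gcongr
      _ = _ := by
        rw [mul_pow, Real.sq_sqrt hK₁.le, ← Real.rpow_natCast, ← Real.rpow_mul (by positivity),
          mul_comm α, hαd]
        norm_num
  · intro a b k
    rw [mixtureGraphon_time hT hφ hφ1 hw1]
    congr 2
    have := mixture_at_node (w := w) (φ := cellBump) (x := fun a => ⟨_, hxm a⟩) (fun a b => by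
      unfold cellBump
      simp only
      rw [mul_div_cancel₀ _ hh'.ne']
      split_ifs with hab
      · rw [hab, sub_self, lineBump_zero]
      · apply lineBump_eq_zero
        rw [add_sub_add_right_eq_sub]
        have hne : (a : ℤ) - (b : ℤ) ≠ 0 := by
          intro h0
          exact hab (Fin.ext (by omega))
        have h1 := Int.one_le_abs hne
        have h2 : (1 : ℝ) ≤ |(a : ℝ) - b| := by exact_mod_cast h1
        linarith) a b
    rw [this]

end PiecewiseSmooth

end DynamicGraphon

namespace DynamicGraphon

/-! ### Tensor distances in coefficients, and finite sums -/

section TensorDistance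

open Matrix

variable {L : ℕ} {H : Matrix (Fin L) (Fin L) ℝ}

/-- The distance between two probability tensors in terms of the transform coefficients. -/
lemma sum_sq_probTensor_sub (hH : H ∈ Matrix.orthogonalGroup (Fin L) ℝ) {n : ℕ}
    {f f' : I → I → I → I} {ζ ζ' : Fin n → I} {W W' : Fin n → Fin n → Fin L → ℝ}
    (hf : ∀ i j k, (f (ζ i) (ζ j) (time k) : ℝ) = 1 / 2 + (Hᵀ *ᵥ W i j) k)
    (hf' : ∀ i j k, (f' (ζ' i) (ζ' j) (time k) : ℝ) = 1 / 2 + (Hᵀ *ᵥ W' i j) k) :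
    ∑ i, ∑ j, ∑ l : Fin L, ((probTensor f ζ i j l : ℝ) - probTensor f' ζ' i j l) ^ 2 =
      ∑ i, ∑ j, if i = j then 0 else ∑ l, (W i j l - W' i j l) ^ 2 := by
  refine Finset.sum_congr rfl fun i _ => Finset.sum_congr rfl fun j _ => ?_
  by_cases hij : i = j
  · simp [hij, probTensor]
  · have h1 := sum_sq_transpose_mulVec hH (W i j - W' i j)
    simp only [Matrix.mulVec_sub, Pi.sub_apply] at h1
    rw [if_neg hij, ← h1]
    simp only [probTensor, if_neg hij, hf, hf', add_sub_add_left_eq_sub]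

lemma TransformCondition.half_add_mem_Icc (hT : TransformCondition H) {w : Fin L → ℝ}
    (hw : ∑ l, |w l| ≤ √(L : ℝ) / 4) (k : Fin L) :
    1 / 2 + (Hᵀ *ᵥ w) k ∈ Set.Icc (1 / 4 : ℝ) (3 / 4) := by
  have hL : 0 < √(L : ℝ) := Real.sqrt_pos.2 (by exact_mod_cast k.pos)
  have h3 : |(Hᵀ *ᵥ w) k| ≤ 1 / 4 :=
    (hT.abs_transpose_mulVec_le w k).trans (by rw [div_le_iff₀ hL]; linarith)
  rw [_root_.abs_le] at h3
  exact ⟨by linarith [h3.1], by linarith [h3.2]⟩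

end TensorDistance

section Sums

lemma sum_comp_eq_sum_card_mul {ι α : Type*} [Fintype ι] [Fintype α] [DecidableEq α] (c : ι → α)
    (f : α → ℝ) : ∑ i, f (c i) = ∑ a, ((Finset.univ.filter fun i => c i = a).card : ℝ) * f a := by
  simp only [Finset.natCast_card_filter, Finset.sum_mul, ite_mul, one_mul, zero_mul]
  rw [Finset.sum_comm]
  simp

lemma sum_edge_add_sum_edge {h : ℕ} (G : Fin h → Fin h → ℝ) (hG : ∀ a b, G a b = G b a)
    (hG0 : ∀ a, G a a = 0) : ∑ a, ∑ b, G a b = 2 * ∑ e : Edge h, G e.1.1 e.1.2 := by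
  have h1 : ∑ e : Edge h, G e.1.1 e.1.2 = ∑ a, ∑ b, if a < b then G a b else 0 := by
    rw [← Fintype.sum_prod_type' (fun a b : Fin h => if a < b then G a b else 0),
      ← Finset.sum_filter]
    exact (Finset.sum_subtype (Finset.univ.filter fun e : Fin h × Fin h => e.1 < e.2)
      (by simp) (fun e : Fin h × Fin h => G e.1 e.2)).symm
  have h2 : ∑ a, ∑ b, (if a < b then G a b else 0) = ∑ a, ∑ b, if b < a then G a b else 0 := by
    rw [Finset.sum_comm]
    simp only [hG]
  rw [h1, two_mul]
  nth_rewrite 2 [h2]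
  simp only [← Finset.sum_add_distrib]
  refine Finset.sum_congr rfl fun a _ => Finset.sum_congr rfl fun b _ => ?_
  rcases lt_trichotomy a b with hab | rfl | hab
  · simp [hab, hab.not_gt]
  · simp [hG0]
  · simp [hab, hab.not_gt]

lemma card_edge (h : ℕ) : (h : ℝ) ^ 2 - h = 2 * Fintype.card (Edge h) := by
  have := sum_edge_add_sum_edge (h := h) (fun a b => if a = b then 0 else 1)
    (fun a b => by simp [eq_comm]) (by simp)
  have h1 : ∀ e : Edge h, (if e.1.1 = e.1.2 then (0 : ℝ) else 1) = 1 :=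
    fun e => if_neg e.2.ne
  simp only [h1, Finset.sum_const, Finset.card_univ, nsmul_eq_mul, mul_one] at this
  rw [← this]
  have h2 : ∀ a b : Fin h, (if a = b then (0 : ℝ) else 1) = 1 - if a = b then 1 else 0 := by
    intro a b; split_ifs <;> simp
  simp only [h2, Finset.sum_sub_distrib]
  simp [sq]

/-- Extension of a vector by zeros. -/
def padZero {N L : ℕ} (u : Fin N → ℝ) (l : Fin L) : ℝ := if hl : (l : ℕ) < N then u ⟨l, hl⟩ else 0

lemma sum_padZero {N L : ℕ} (hNL : N ≤ L) (F : ℕ → ℝ → ℝ) (hF : ∀ l, F l 0 = 0) (u : Fin N → ℝ) :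
    ∑ l : Fin L, F l (padZero u l) = ∑ l : Fin N, F l (u l) := by
  obtain ⟨d, rfl⟩ := Nat.exists_eq_add_of_le hNL
  rw [Fin.sum_univ_add]
  simp [padZero, hF]

lemma padZero_sub {N L : ℕ} (u u' : Fin N → ℝ) (l : Fin L) :
    padZero u l - padZero u' l = padZero (u - u') l := by
  unfold padZero
  split_ifs <;> simp

end Sums

/-! ### Independent perturbations of block pairs -/

section Blocks

/-- The block of a node when the nodes are dealt out cyclically to `h` blocks. -/
def cyclicBlock {n h : ℕ} (hh : 0 < h) (i : Fin n) : Fin h := ⟨i % h, Nat.mod_lt _ hh⟩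

lemma card_cyclicBlock_ge {n h : ℕ} (hh : 0 < h) (a : Fin h) :
    n / h ≤ (Finset.univ.filter fun i : Fin n => cyclicBlock hh i = a).card := by
  have hlt : ∀ t : Fin (n / h), (a : ℕ) + h * t < n := by
    intro t
    have h1 : h * ((t : ℕ) + 1) ≤ h * (n / h) := Nat.mul_le_mul_left _ t.isLt
    have h2 := Nat.mul_div_le n h
    have h3 := a.isLt
    rw [mul_add] at h1
    omega
  have := Finset.card_le_card_of_injOn (s := (Finset.univ : Finset (Fin (n / h))))
    (t := Finset.univ.filter fun i : Fin n => cyclicBlock hh i = a)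
    (fun t => ⟨(a : ℕ) + h * t, hlt t⟩)
    (fun t _ => by
      simp [cyclicBlock, Fin.ext_iff, Nat.mod_eq_of_lt a.isLt])
    (fun t _ t' _ htt => by
      simp only [Fin.mk.injEq, add_right_inj] at htt
      exact Fin.ext (Nat.eq_of_mul_eq_mul_left hh htt))
  simpa using this

lemma card_cyclicBlock_le {n h : ℕ} (hh : 0 < h) (a : Fin h) :
    (Finset.univ.filter fun i : Fin n => cyclicBlock hh i = a).card ≤ n / h + 1 := by
  have := Finset.card_le_card_of_injOn
    (s := Finset.univ.filter fun i : Fin n => cyclicBlock hh i = a)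
    (t := Finset.range (n / h + 1)) (fun i => (i : ℕ) / h)
    (fun i _ => by
      simp only [Finset.coe_range, Set.mem_Iio]
      exact Nat.lt_succ_of_le (Nat.div_le_div_right i.isLt.le))
    (fun i hi j hj hij => by
      simp only [Finset.coe_filter, Finset.mem_univ, true_and, cyclicBlock, Fin.ext_iff] at hi hj
      refine Fin.ext ?_
      rw [← Nat.div_add_mod (i : ℕ) h, ← Nat.div_add_mod (j : ℕ) h]
      have h1 : (i : ℕ) % h = a := hi
      have h2 : (j : ℕ) % h = a := hj
      have h3 : (i : ℕ) / h = (j : ℕ) / h := hij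
      rw [h1, h2, h3])
  simpa using this

/-- The quotient is at least one, so rounding down at most halves it. -/
lemma half_div_le_natDiv {n h : ℕ} (hh : 0 < h) (hhn : h ≤ n) :
    (n : ℝ) / h / 2 ≤ ((n / h : ℕ) : ℝ) := by
  have h1 : 1 ≤ n / h := (Nat.one_le_div_iff hh).2 hhn
  have h2 := Nat.lt_floor_add_one ((n : ℝ) / h)
  rw [Nat.floor_div_natCast, Nat.floor_natCast] at h2
  have h3 : (1 : ℝ) ≤ ((n / h : ℕ) : ℝ) := by exact_mod_cast h1
  linarith

lemma natDiv_add_one_le {n h : ℕ} (hh : 0 < h) (hhn : h ≤ n) :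
    ((n / h : ℕ) : ℝ) + 1 ≤ 2 * ((n : ℝ) / h) := by
  have hh' : (0 : ℝ) < h := by exact_mod_cast hh
  have h1 : (1 : ℝ) ≤ (n : ℝ) / h := (one_le_div hh').2 (by exact_mod_cast hhn)
  have h2 : ((n / h : ℕ) : ℝ) ≤ (n : ℝ) / h := Nat.cast_div_le
  linarith

/-- The transform coefficients of a pair of blocks for a given sign pattern. -/
def blockVec {h N : ℕ} (γ : ℝ) (θ : Edge h × Fin N → Bool) (a b : Fin h) (l : Fin N) : ℝ :=
  if hab : a < b then (if θ (⟨(a, b), hab⟩, l) then γ else 0)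
  else if hba : b < a then (if θ (⟨(b, a), hba⟩, l) then γ else 0) else 0

lemma blockVec_symm {h N : ℕ} (γ : ℝ) (θ : Edge h × Fin N → Bool) (a b : Fin h) :
    blockVec γ θ a b = blockVec γ θ b a := by
  ext l
  unfold blockVec
  rcases lt_trichotomy a b with hab | rfl | hab
  · simp [hab, hab.not_gt]
  · rfl
  · simp [hab, hab.not_gt]

lemma blockVec_edge {h N : ℕ} (γ : ℝ) (θ : Edge h × Fin N → Bool) (e : Edge h) (l : Fin N) :
    blockVec γ θ e.1.1 e.1.2 l = if θ (e, l) then γ else 0 := by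
  have := e.2
  simp [blockVec, this]

lemma blockVec_self {h N : ℕ} (γ : ℝ) (θ : Edge h × Fin N → Bool) (a : Fin h) (l : Fin N) :
    blockVec γ θ a a l = 0 := by
  simp [blockVec]

lemma abs_blockVec_le {h N : ℕ} {γ : ℝ} (hγ : 0 ≤ γ) (θ : Edge h × Fin N → Bool) (a b : Fin h)
    (l : Fin N) : |blockVec γ θ a b l| ≤ γ := by
  unfold blockVec
  split_ifs <;> simp [abs_of_nonneg hγ, hγ]

lemma sum_sq_blockVec_sub {h N : ℕ} (γ : ℝ) (θ θ' : Edge h × Fin N → Bool) :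
    ∑ a, ∑ b, ∑ l, (blockVec γ θ a b l - blockVec γ θ' a b l) ^ 2 =
      2 * γ ^ 2 * hammingDist θ θ' := by
  rw [sum_edge_add_sum_edge (fun a b => ∑ l, (blockVec γ θ a b l - blockVec γ θ' a b l) ^ 2)
    (fun a b => by rw [blockVec_symm γ θ, blockVec_symm γ θ']) (fun a => by simp [blockVec_self])]
  have h1 : (hammingDist θ θ' : ℝ) = ∑ e, ∑ l, if θ (e, l) = θ' (e, l) then (0 : ℝ) else 1 := by
    rw [← Fintype.sum_prod_type' (fun e l => if θ (e, l) = θ' (e, l) then (0 : ℝ) else 1)]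
    simp [hammingDist, Finset.sum_ite]
  rw [h1, mul_assoc]
  simp only [Finset.mul_sum]
  refine Finset.sum_congr rfl fun e _ => Finset.sum_congr rfl fun l _ => ?_
  rw [blockVec_edge, blockVec_edge]
  cases θ (e, l) <;> cases θ' (e, l) <;> simp

/-- Lower bound from independent perturbations of the first `N` coefficients of all block pairs. -/
theorem minimaxProb_ge_of_blocks {n L N h : ℕ} {H : Matrix (Fin L) (Fin L) ℝ}
    (hH : H ∈ Matrix.orthogonalGroup (Fin L) ℝ) (hT : TransformCondition H)
    {𝓕 : Set (I → I → I → I)} (hh : 2 ≤ h) (hhn : h ≤ n) (hN : 1 ≤ N) (hNL : N ≤ L)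
    {ν₂ K₂ g γ : ℝ} (hν₂ : 0 < ν₂) (hreal : Realizable H 𝓕 h ν₂ K₂ g) (hγ : 0 < γ) (hγg : γ ≤ g)
    (hinfo : γ ^ 2 * ((n : ℝ) / h) ^ 2 ≤ 1 / 5000) (hNγ : N * γ ≤ √(L : ℝ) / 4)
    (hK : γ ^ 2 * (N : ℝ) ^ (2 * ν₂ + 1) ≤ K₂) :
    1 / 4 ≤ minimaxProb n L 𝓕 (γ ^ 2 * N / (256 * L)) := by
  classical
  have hh0 : 0 < h := by omega
  have hhR : (2 : ℝ) ≤ h := by exact_mod_cast hh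
  have hL0 : 0 < L := by omega
  have hLR : (0 : ℝ) < L := by exact_mod_cast hL0
  have hNR : (0 : ℝ) < N := by exact_mod_cast hN
  have hnR : (0 : ℝ) < n := by exact_mod_cast (by omega : 0 < n)
  set w : (Edge h × Fin N → Bool) → Fin h → Fin h → Fin L → ℝ :=
    fun θ a b => padZero (blockVec γ θ a b) with hw
  have hw1 : ∀ θ a b, ∑ l, |w θ a b l| ≤ √(L : ℝ) / 4 := by
    intro θ a b
    have h1 := sum_padZero hNL (fun _ t => |t|) (by simp) (blockVec γ θ a b)
    simp only [hw]
    rw [h1]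
    refine (Finset.sum_le_sum fun l _ => abs_blockVec_le hγ.le θ a b l).trans ?_
    simpa using hNγ
  have hw2 : ∀ θ a b, ∑ l : Fin L, (l : ℝ) ^ (2 * ν₂) * w θ a b l ^ 2 ≤ K₂ := by
    intro θ a b
    have h1 := sum_padZero hNL (fun l t => (l : ℝ) ^ (2 * ν₂) * t ^ 2) (by simp) (blockVec γ θ a b)
    simp only [hw]
    rw [h1]
    refine (Finset.sum_le_sum (g := fun _ => (N : ℝ) ^ (2 * ν₂) * γ ^ 2) fun l _ => ?_).trans
      (le_trans ?_ hK)
    · have h2 : (l : ℝ) ≤ N := by exact_mod_cast l.isLt.le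
      have h3 : blockVec γ θ a b l ^ 2 ≤ γ ^ 2 := by
        rw [← sq_abs]
        exact pow_le_pow_left₀ (abs_nonneg _) (abs_blockVec_le hγ.le θ a b l) 2
      gcongr
    · rw [Finset.sum_const, Finset.card_univ, Fintype.card_fin, nsmul_eq_mul,
        Real.rpow_add hNR, Real.rpow_one]
      exact le_of_eq (by ring)
  have hw3 : ∀ θ a b l, |w θ a b l| ≤ g := by
    intro θ a b l
    refine le_trans ?_ hγg
    simp only [hw, padZero]
    split_ifs
    · exact abs_blockVec_le hγ.le θ a b _
    · simpa using hγ.le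
  have hws : ∀ θ a b, w θ a b = w θ b a := by
    intro θ a b
    simp only [hw]
    rw [blockVec_symm]
  choose f hf x hx using fun θ => hreal (w θ) (hws θ) (hw1 θ) (hw2 θ) (hw3 θ)
  have hdist : ∀ θ θ' : Edge h × Fin N → Bool,
      ∑ i, ∑ j, ∑ l : Fin L, ((probTensor (f θ) (fun i : Fin n => x θ (cyclicBlock hh0 i)) i j l : ℝ) -
        probTensor (f θ') (fun i => x θ' (cyclicBlock hh0 i)) i j l) ^ 2 =
      ∑ a : Fin h, ∑ b : Fin h, ((Finset.univ.filter fun i : Fin n => cyclicBlock hh0 i = a).card : ℝ) *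
        ((Finset.univ.filter fun i : Fin n => cyclicBlock hh0 i = b).card : ℝ) *
          ∑ l, (blockVec γ θ a b l - blockVec γ θ' a b l) ^ 2 := by
    intro θ θ'
    have h0 : ∀ a b : Fin h, ∑ l, (w θ a b l - w θ' a b l) ^ 2 =
        ∑ l, (blockVec γ θ a b l - blockVec γ θ' a b l) ^ 2 := by
      intro a b
      simp only [hw, padZero_sub]
      exact sum_padZero hNL (fun _ t => t ^ 2) (by simp) _
    rw [sum_sq_probTensor_sub hH (fun i j k => hx θ (cyclicBlock hh0 i) (cyclicBlock hh0 j) k)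
      (fun i j k => hx θ' (cyclicBlock hh0 i) (cyclicBlock hh0 j) k)]
    simp only [h0]
    -- Perturbations vanish within a block, so the zero diagonal of the tensor needs no correction.
    have h1 : ∀ i j : Fin n, (if i = j then 0 else ∑ l, (blockVec γ θ (cyclicBlock hh0 i)
        (cyclicBlock hh0 j) l - blockVec γ θ' (cyclicBlock hh0 i) (cyclicBlock hh0 j) l) ^ 2) =
        ∑ l, (blockVec γ θ (cyclicBlock hh0 i)
        (cyclicBlock hh0 j) l - blockVec γ θ' (cyclicBlock hh0 i) (cyclicBlock hh0 j) l) ^ 2 := by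
      intro i j
      split_ifs with hij
      · simp [hij, blockVec_self]
      · rfl
    simp only [h1]
    rw [sum_comp_eq_sum_card_mul (cyclicBlock hh0) (fun a => ∑ j : Fin n, ∑ l,
      (blockVec γ θ a (cyclicBlock hh0 j) l - blockVec γ θ' a (cyclicBlock hh0 j) l) ^ 2)]
    refine Finset.sum_congr rfl fun a _ => ?_
    rw [sum_comp_eq_sum_card_mul (cyclicBlock hh0) (fun b => ∑ l,
      (blockVec γ θ a b l - blockVec γ θ' a b l) ^ 2), Finset.mul_sum]
    exact Finset.sum_congr rfl fun b _ => (mul_assoc _ _ _).symm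
  have hcard_ge : ∀ a : Fin h, (n : ℝ) / h / 2 ≤
      ((Finset.univ.filter fun i : Fin n => cyclicBlock hh0 i = a).card : ℝ) := fun a =>
    (half_div_le_natDiv hh0 hhn).trans (by exact_mod_cast card_cyclicBlock_ge hh0 a)
  have hcard_le : ∀ a : Fin h, ((Finset.univ.filter fun i : Fin n => cyclicBlock hh0 i = a).card : ℝ)
      ≤ 2 * ((n : ℝ) / h) := fun a =>
    le_trans (by exact_mod_cast card_cyclicBlock_le hh0 a) (natDiv_add_one_le hh0 hhn)
  have hsum_le : ∀ θ θ' : Edge h × Fin N → Bool, ∑ a : Fin h, ∑ b : Fin h,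
      ((Finset.univ.filter fun i : Fin n => cyclicBlock hh0 i = a).card : ℝ) *
        ((Finset.univ.filter fun i : Fin n => cyclicBlock hh0 i = b).card : ℝ) *
          ∑ l, (blockVec γ θ a b l - blockVec γ θ' a b l) ^ 2 ≤
      (2 * ((n : ℝ) / h)) ^ 2 * (2 * γ ^ 2 * hammingDist θ θ') := by
    intro θ θ'
    rw [← sum_sq_blockVec_sub, Finset.mul_sum]
    simp only [Finset.mul_sum (s := (Finset.univ : Finset (Fin h)))]
    refine Finset.sum_le_sum fun a _ => Finset.sum_le_sum fun b _ => ?_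
    rw [sq]
    gcongr
    · exact hcard_le a
    · exact hcard_le b
  have hsum_ge : ∀ θ θ' : Edge h × Fin N → Bool,
      ((n : ℝ) / h / 2) ^ 2 * (2 * γ ^ 2 * hammingDist θ θ') ≤ ∑ a : Fin h, ∑ b : Fin h,
      ((Finset.univ.filter fun i : Fin n => cyclicBlock hh0 i = a).card : ℝ) *
        ((Finset.univ.filter fun i : Fin n => cyclicBlock hh0 i = b).card : ℝ) *
          ∑ l, (blockVec γ θ a b l - blockVec γ θ' a b l) ^ 2 := by
    intro θ θ'
    rw [← sum_sq_blockVec_sub, Finset.mul_sum]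
    simp only [Finset.mul_sum (s := (Finset.univ : Finset (Fin h)))]
    refine Finset.sum_le_sum fun a _ => Finset.sum_le_sum fun b _ => ?_
    rw [sq]
    gcongr
    · exact hcard_ge a
    · exact hcard_ge b
  have hEpos : 0 < Fintype.card (Edge h) := Fintype.card_pos_iff.2
    ⟨⟨(⟨0, by omega⟩, ⟨1, by omega⟩), by simp [Fin.lt_def]⟩⟩
  have hE := card_edge h
  have : Nonempty (Edge h × Fin N) := by
    rw [← Fintype.card_pos_iff, Fintype.card_prod, Fintype.card_fin]
    positivity
  refine minimaxProb_ge_of_cube (by omega) hL0 (κ := Edge h × Fin N) (A := Bool) false (by simp) 𝓕 f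
    (fun θ i => x θ (cyclicBlock hh0 i)) hf ?_ ?_ (((n : ℝ) / h / 2) ^ 2 * (2 * γ ^ 2)) ?_
    (by positivity) _ ?_
  · intro θ i j l _
    rw [hx]
    exact hT.half_add_mem_Icc (hw1 _ _ _) l
  · intro θ k
    rw [hdist]
    refine (hsum_le _ _).trans ?_
    have h1 : (hammingDist θ (Function.update θ k false) : ℝ) ≤ 1 := by
      have : hammingDist θ (Function.update θ k false) ≤ 1 := by
        unfold hammingDist
        refine Finset.card_le_one.2 fun p hp q hq => ?_
        have aux : ∀ p, p ∈ Finset.univ.filter (fun i => θ i ≠ Function.update θ k false i) →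
            p = k := by
          intro p hp
          by_contra hpk
          simp [hpk] at hp
        rw [aux p hp, aux q hq]
      exact_mod_cast this
    have h2 := Real.log_two_gt_d9
    simp only [Fintype.card_bool, Nat.cast_ofNat]
    -- A single switch costs at most `8/5000`, below `log 2 / 342`.
    have h3 : (2 * ((n : ℝ) / h)) ^ 2 * (2 * γ ^ 2 * hammingDist θ (Function.update θ k false)) ≤
        8 * (γ ^ 2 * ((n : ℝ) / h) ^ 2) * 1 := by
      calc _ = 8 * (γ ^ 2 * ((n : ℝ) / h) ^ 2) * hammingDist θ (Function.update θ k false) := by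
            ring
        _ ≤ _ := by gcongr
    linarith
  · intro θ θ'
    rw [hdist]
    refine le_trans (le_of_eq ?_) (hsum_ge θ θ')
    ring
  · rw [Fintype.card_prod, Fintype.card_fin, Nat.cast_mul]
    -- This uses `h ≥ 2`. The factors 1/4 and 2 of the separation, this 1/4 and the 1/32 of the cube
    -- bound multiply to 1/256.
    have h1 : (h : ℝ) ^ 2 / 4 ≤ Fintype.card (Edge h) := by nlinarith
    calc γ ^ 2 * N / (256 * L) * ((n : ℝ) ^ 2 * L)
        = ((n : ℝ) / h / 2) ^ 2 * (2 * γ ^ 2) * ((h : ℝ) ^ 2 / 4 * N) / 32 := by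
          field_simp; ring
      _ ≤ _ := by gcongr

end Blocks

end DynamicGraphon

namespace DynamicGraphon

lemma minimaxProb_anti {n L : ℕ} {𝓕 : Set (I → I → I → I)} {Δ Δ' : ℝ} (h : Δ ≤ Δ') :
    minimaxProb n L 𝓕 Δ' ≤ minimaxProb n L 𝓕 Δ := by
  unfold minimaxProb
  refine iInf_mono fun Λ' => iSup₂_mono fun f _ => iSup_mono fun ζ => measure_mono fun b hb => ?_
  exact h.trans hb

/-! ### Optimal number of perturbed coefficients -/

section BlockRate

/-- The block lower bound with the optimal number of perturbed coefficients. -/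
theorem minimaxProb_ge_blockRate {n L h : ℕ} {H : Matrix (Fin L) (Fin L) ℝ}
    (hH : H ∈ Matrix.orthogonalGroup (Fin L) ℝ) (hT : TransformCondition H)
    {𝓕 : Set (I → I → I → I)} (hh : 2 ≤ h) (hhn : h ≤ n) (hL : 1 ≤ L)
    {ν₂ K₂ g ε c : ℝ} (hν₂ : 1 / 2 ≤ ν₂) (hreal : Realizable H 𝓕 h ν₂ K₂ g)
    (hε : 0 < ε) (hε1 : ε ≤ 1) (hεn : ε * ((n : ℝ) / h) ^ 2 ≤ 1) (hc : 0 < c) (hc1 : c ≤ 1 / 5000)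
    (hcK : c ≤ K₂) (hg : √(c * ε) ≤ g) :
    1 / 4 ≤ minimaxProb n L 𝓕
      (c / 512 * min (1 / (L : ℝ) * ε ^ (2 * ν₂ / (2 * ν₂ + 1))) ε) := by
  have hLR : (1 : ℝ) ≤ L := by exact_mod_cast hL
  set q : ℝ := 2 * ν₂ + 1 with hq
  have hq2 : 2 ≤ q := by rw [hq]; linarith
  -- `X` solves `ε X^q = 1`, so `N ≤ X` is what the temporal smoothness constraint permits at
  -- amplitude `γ² = c ε`.
  set X : ℝ := ε ^ (-(1 / q)) with hX
  have hX1 : 1 ≤ X := Real.one_le_rpow_of_pos_of_le_one_of_nonpos hε hε1 (by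
    have : 0 ≤ 1 / q := by positivity
    linarith)
  set N : ℕ := min L ⌊X⌋₊ with hNd
  have hfl : 1 ≤ ⌊X⌋₊ := Nat.one_le_floor_iff _ |>.2 hX1
  have hN : 1 ≤ N := le_min hL hfl
  have hNR : (1 : ℝ) ≤ N := by exact_mod_cast hN
  have hNX : (N : ℝ) ≤ X := le_trans (by exact_mod_cast min_le_right _ _)
    (Nat.floor_le (by linarith))
  have hXq : X ^ q = 1 / ε := by
    rw [hX, ← Real.rpow_mul hε.le, neg_mul, one_div_mul_cancel (by positivity), Real.rpow_neg_one,
      one_div]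
  have hγ2 : √(c * ε) ^ 2 = c * ε := Real.sq_sqrt (by positivity)
  have hNq : c * ε * (N : ℝ) ^ q ≤ c := by
    calc c * ε * (N : ℝ) ^ q ≤ c * ε * X ^ q := by gcongr
      _ = c := by rw [hXq]; field_simp
  have hmain := minimaxProb_ge_of_blocks hH hT hh hhn hN (min_le_left _ _) (by linarith) hreal
    (γ := √(c * ε)) (by positivity) hg
    (by rw [hγ2, mul_assoc]; nlinarith) (by
      -- Here `ν₂ ≥ 1/2` enters: with `q ≥ 2` the smoothness budget also controls `(N γ)²`, hence
      -- the l1 norm.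
      have h1 : (N : ℝ) ^ (2 : ℝ) ≤ (N : ℝ) ^ q := Real.rpow_le_rpow_of_exponent_le hNR hq2
      rw [Real.rpow_two] at h1
      have h2 : (N * √(c * ε)) ^ 2 ≤ (1 / 4 : ℝ) ^ 2 := by
        rw [mul_pow, hγ2]
        have : c * ε * (N : ℝ) ^ 2 ≤ c * ε * (N : ℝ) ^ q := by gcongr
        nlinarith
      have h3 := abs_le_of_sq_le_sq h2 (by norm_num)
      have h4 : 1 ≤ √(L : ℝ) := Real.one_le_sqrt.2 hLR
      have h5 := le_abs_self (N * √(c * ε))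
      linarith)
    (by rw [hγ2]; exact hNq.trans hcK)
  refine hmain.trans (minimaxProb_anti ?_)
  rw [hγ2]
  have hL0 : (0 : ℝ) < L := by linarith
  rcases min_choice L ⌊X⌋₊ with hm | hm
  · have hNL : (N : ℝ) = L := by rw [hNd, hm]
    rw [hNL]
    calc c / 512 * min (1 / (L : ℝ) * ε ^ (2 * ν₂ / q)) ε ≤ c / 512 * ε := by
          gcongr; exact min_le_right _ _
      _ ≤ c * ε * L / (256 * L) := by
          rw [mul_div_mul_right _ _ hL0.ne']
          nlinarith [mul_pos hc hε]
  -- Rounding costs a factor 2, which turns 256 into 512.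
  · have hNX2 : X / 2 ≤ N := by
      rw [hNd, hm]
      have h1 := Nat.lt_floor_add_one X
      have h2 : (1 : ℝ) ≤ ⌊X⌋₊ := by exact_mod_cast hfl
      linarith
    have hεX : ε * X = ε ^ (2 * ν₂ / q) := by
      have : 2 * ν₂ / q = 1 + -(1 / q) := by
        field_simp; rw [hq]; ring
      rw [this, Real.rpow_add hε, Real.rpow_one]
    calc c / 512 * min (1 / (L : ℝ) * ε ^ (2 * ν₂ / q)) ε
        ≤ c / 512 * (1 / (L : ℝ) * ε ^ (2 * ν₂ / q)) := by
          gcongr; exact min_le_left _ _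
      _ = c * ε * (X / 2) / (256 * L) := by rw [← hεX]; field_simp; norm_num
      _ ≤ _ := by gcongr

end BlockRate

/-! ### Unknown node labels and anchors -/

section Labels

open Matrix

/-- The indicator of a nonzero element of the field with two elements. -/
def bitValue (x : ZMod 2) : ℝ := if x = 0 then 0 else 1

lemma sq_bitValue_sub (x y : ZMod 2) : (bitValue x - bitValue y) ^ 2 = bitValue (x - y) := by
  have h : ∀ z : ZMod 2, z = 0 ∨ z = 1 := by decide
  rcases h x with rfl | rfl <;> rcases h y with rfl | rfl <;> simp [bitValue]

lemma bitValue_add_one (x : ZMod 2) : bitValue (x + 1) = 1 - bitValue x := by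
  have h : ∀ z : ZMod 2, z = 0 ∨ z = 1 := by decide
  have h2 : (1 : ZMod 2) + 1 = 0 := by decide
  rcases h x with rfl | rfl <;> simp [bitValue, h2]

lemma bitValue_nonneg (x : ZMod 2) : 0 ≤ bitValue x := by
  unfold bitValue; split_ifs <;> norm_num

lemma bitValue_le_one (x : ZMod 2) : bitValue x ≤ 1 := by
  unfold bitValue; split_ifs <;> norm_num

/-- A nonzero linear functional over the field with two elements is nonzero half of the time. -/
lemma sum_bitValue_dotProduct {k : ℕ} {v : Fin k → ZMod 2} (hv : v ≠ 0) :
    ∑ b, bitValue (v ⬝ᵥ b) = 2 ^ k / 2 := by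
  obtain ⟨i, hi⟩ := Function.ne_iff.1 hv
  have hi1 : v i = 1 := by
    have h : ∀ z : ZMod 2, z ≠ 0 → z = 1 := by decide
    exact h _ hi
  -- Translation by a basis vector on which `v` is one flips the value of the functional.
  have h1 := Equiv.sum_comp (Equiv.addRight (Pi.single i (1 : ZMod 2)))
    (fun b => bitValue (v ⬝ᵥ b))
  simp only [Equiv.coe_addRight, dotProduct_add, dotProduct_single, hi1, mul_one, bitValue_add_one,
    Finset.sum_sub_distrib, Finset.sum_const, Finset.card_univ, nsmul_eq_mul] at h1
  have h2 : ((Fintype.card (Fin k → ZMod 2) : ℕ) : ℝ) = 2 ^ k := by simp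
  rw [h2] at h1
  linarith

/-- An enumeration of the nonzero vectors over the field with two elements. -/
noncomputable def nonzeroEquiv (k : ℕ) : Fin (2 ^ k - 1) ≃ {b : Fin k → ZMod 2 // b ≠ 0} :=
  (Fintype.equivFinOfCardEq (by rw [Fintype.card_subtype_compl]; simp)).symm

/-- Anchor nodes with all nonzero labels in turn. -/
noncomputable def anchorLabel {k d : ℕ} (hk : 0 < 2 ^ k - 1) (j : Fin d) : Fin k → ZMod 2 :=
  (nonzeroEquiv k (cyclicBlock hk j)).1

lemma sum_sq_anchor_ge {k d : ℕ} (hk : 0 < 2 ^ k - 1) (hkd : 2 ^ k - 1 ≤ d)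
    {a a' : Fin k → ZMod 2} (haa : a ≠ a') :
    (d : ℝ) / 4 ≤ ∑ j : Fin d, (bitValue (a ⬝ᵥ anchorLabel hk j) -
      bitValue (a' ⬝ᵥ anchorLabel hk j)) ^ 2 := by
  classical
  simp only [sq_bitValue_sub, ← sub_dotProduct]
  have hv : a - a' ≠ 0 := sub_ne_zero.2 haa
  unfold anchorLabel
  rw [sum_comp_eq_sum_card_mul (cyclicBlock hk)
    (fun c => bitValue ((a - a') ⬝ᵥ (nonzeroEquiv k c).1))]
  -- Omitting the zero label loses nothing, since the functional vanishes there; for `k = 1` a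
  -- single anchor then suffices, which allows `n = 2`.
  have h1 : ∑ c, bitValue ((a - a') ⬝ᵥ (nonzeroEquiv k c).1) = 2 ^ k / 2 := by
    rw [Equiv.sum_comp (nonzeroEquiv k) (fun b => bitValue ((a - a') ⬝ᵥ b.1)),
      ← sum_bitValue_dotProduct hv]
    rw [← Finset.sum_subtype (Finset.univ.erase (0 : Fin k → ZMod 2)) (by simp)
      (fun b => bitValue ((a - a') ⬝ᵥ b))]
    apply Finset.sum_erase
    simp [bitValue]
  have h2 : ((2 ^ k - 1 : ℕ) : ℝ) ≤ 2 ^ k := by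
    exact_mod_cast Nat.sub_le _ _
  have hk' : (0 : ℝ) < ((2 ^ k - 1 : ℕ) : ℝ) := by exact_mod_cast hk
  calc (d : ℝ) / 4 ≤ (d : ℝ) / ((2 ^ k - 1 : ℕ) : ℝ) / 2 * (2 ^ k / 2) := by
        rw [div_div, div_mul_div_comm, div_le_div_iff₀ (by norm_num) (by positivity)]
        have hd : (0 : ℝ) ≤ d := Nat.cast_nonneg d
        nlinarith
    _ = ∑ c, (d : ℝ) / ((2 ^ k - 1 : ℕ) : ℝ) / 2 *
          bitValue ((a - a') ⬝ᵥ (nonzeroEquiv k c).1) := by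
        rw [← h1, Finset.mul_sum]
    _ ≤ _ := by
        refine Finset.sum_le_sum fun c _ => ?_
        refine mul_le_mul_of_nonneg_right ?_ (bitValue_nonneg _)
        exact (half_div_le_natDiv hk hkd).trans (by exact_mod_cast card_cyclicBlock_ge hk c)

/-- Lower bound from unknown labels of `m` nodes, in the presence of `d` anchor nodes. -/
theorem minimaxProb_ge_of_labels {m d L k : ℕ} {H : Matrix (Fin L) (Fin L) ℝ}
    (hH : H ∈ Matrix.orthogonalGroup (Fin L) ℝ) (hT : TransformCondition H)
    {𝓕 : Set (I → I → I → I)} (hL : 0 < L) (hm : 1 ≤ m) (hmd : m ≤ d) (hdm : d ≤ 2 * m)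
    (hk : 1 ≤ k) (hkd : 2 ^ k - 1 ≤ d) {ν₂ K₂ g η : ℝ} (hν₂ : 0 < ν₂) (hK₂ : 0 ≤ K₂)
    (hreal : Realizable H 𝓕 (2 ^ k) ν₂ K₂ g) (hη : 0 < η) (hη4 : η ≤ 1 / 4)
    (hηg : η * √(L : ℝ) ≤ g) (hinfo : 2000 * η ^ 2 * ((m + d : ℕ) * L) ≤ k) :
    1 / 4 ≤ minimaxProb (m + d) L 𝓕 (η ^ 2 / 768) := by
  classical
  have hLR : (0 : ℝ) < L := by exact_mod_cast hL
  have hsL : 0 < √(L : ℝ) := Real.sqrt_pos.2 hLR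
  have hk0 : 0 < 2 ^ k - 1 := by
    have : 2 ^ 1 ≤ 2 ^ k := Nat.pow_le_pow_right (by norm_num) hk
    omega
  let ι : (Fin k → ZMod 2) ≃ Fin (2 ^ k) := Fintype.equivFinOfCardEq (by simp)
  -- Only the coefficient of index zero is used: its temporal weight is zero, and a shift `η √L`
  -- carries squared norm `η² L`.
  set u : (Fin k → ZMod 2) → (Fin k → ZMod 2) → Fin L → ℝ := fun a b =>
    padZero (fun _ : Fin 1 => η * √(L : ℝ) * bitValue (a ⬝ᵥ b)) with hu
  have hub : ∀ a b : Fin k → ZMod 2, |η * √(L : ℝ) * bitValue (a ⬝ᵥ b)| ≤ η * √(L : ℝ) := by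
    intro a b
    rw [abs_of_nonneg (mul_nonneg (by positivity) (bitValue_nonneg _))]
    exact mul_le_of_le_one_right (by positivity) (bitValue_le_one _)
  have hu1 : ∀ a b, ∑ l, |u a b l| ≤ √(L : ℝ) / 4 := by
    intro a b
    simp only [hu]
    rw [sum_padZero hL (fun _ t => |t|) (by simp)]
    simp only [Finset.univ_unique, Finset.sum_singleton]
    refine (hub a b).trans ?_
    nlinarith
  obtain ⟨f, hf, x, hx⟩ := hreal (fun a b => u (ι.symm a) (ι.symm b))
    (fun a b => by simp only [hu]; rw [dotProduct_comm]) (fun a b => hu1 _ _)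
    (fun a b => by
      simp only [hu]
      rw [sum_padZero hL (fun l t => (l : ℝ) ^ (2 * ν₂) * t ^ 2) (by simp)]
      simpa [Real.zero_rpow (by positivity : 2 * ν₂ ≠ 0)] using hK₂)
    (fun a b l => by
      refine le_trans ?_ hηg
      simp only [hu, padZero]
      split_ifs
      · exact hub _ _
      · simp only [abs_zero]; positivity)
  set lab : (Fin m → Fin k → ZMod 2) → Fin (m + d) → Fin k → ZMod 2 := fun θ =>
    Fin.append θ (anchorLabel hk0) with hlab
  have hval : ∀ θ i j l, (f (x (ι (lab θ i))) (x (ι (lab θ j))) (time l) : ℝ) =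
      1 / 2 + (Hᵀ *ᵥ u (lab θ i) (lab θ j)) l := by
    intro θ i j l
    rw [hx]
    simp
  have hdist : ∀ θ θ' : Fin m → Fin k → ZMod 2,
      ∑ i, ∑ j, ∑ l : Fin L, ((probTensor f (fun i => x (ι (lab θ i))) i j l : ℝ) -
        probTensor f (fun i => x (ι (lab θ' i))) i j l) ^ 2 =
      ∑ i, ∑ j, if i = j then 0 else η ^ 2 * L *
        (bitValue (lab θ i ⬝ᵥ lab θ j) - bitValue (lab θ' i ⬝ᵥ lab θ' j)) ^ 2 := by
    intro θ θ'
    rw [sum_sq_probTensor_sub hH (hval θ) (hval θ')]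
    refine Finset.sum_congr rfl fun i _ => Finset.sum_congr rfl fun j _ => ?_
    congr 1
    simp only [hu, padZero_sub]
    rw [sum_padZero hL (fun _ t => t ^ 2) (by simp)]
    simp only [Finset.univ_unique, Finset.sum_singleton, Pi.sub_apply]
    rw [← mul_sub, mul_pow, mul_pow, Real.sq_sqrt hLR.le]
  have hbit : ∀ y z : ZMod 2, (bitValue y - bitValue z) ^ 2 ≤ 1 := fun y z => by
    rw [sq_bitValue_sub]; exact bitValue_le_one _
  have hne : Nonempty (Fin m) := ⟨⟨0, hm⟩⟩
  have hmR : (1 : ℝ) ≤ m := by exact_mod_cast hm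
  have hmdR : (m : ℝ) ≤ d := by exact_mod_cast hmd
  have hdmR : (d : ℝ) ≤ 2 * m := by exact_mod_cast hdm
  refine minimaxProb_ge_of_cube (by omega) hL (κ := Fin m) (A := Fin k → ZMod 2) 0 ?_ 𝓕
    (fun _ => f) (fun θ i => x (ι (lab θ i))) (fun _ => hf) ?_ ?_ (η ^ 2 * L * (d / 4)) ?_
    (by positivity) _ ?_
  · simp only [Fintype.card_pi, ZMod.card, Finset.prod_const, Finset.card_univ, Fintype.card_fin]
    omega
  · intro θ i j l _
    rw [hval]
    exact hT.half_add_mem_Icc (hu1 _ _) l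
  · intro θ p
    rw [hdist]
    have hlabeq : ∀ i, i ≠ Fin.castAdd d p → lab (Function.update θ p 0) i = lab θ i := by
      intro i
      refine Fin.addCases (fun i hi => ?_) (fun j _ => ?_) i
      · have : i ≠ p := fun h => hi (by rw [h])
        simp [hlab, this]
      · simp [hlab]
    -- Relabelling node `p` affects only its row and column, in total at most `2 (m + d) η² L`; the
    -- constant 2000 brings this below `k log 2 / 342`.
    have hle : ∀ i j : Fin (m + d), (if i = j then 0 else η ^ 2 * L *
        (bitValue (lab θ i ⬝ᵥ lab θ j) - bitValue (lab (Function.update θ p 0) i ⬝ᵥ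
          lab (Function.update θ p 0) j)) ^ 2) ≤
        η ^ 2 * L * ((if i = Fin.castAdd d p then 1 else 0) +
          (if j = Fin.castAdd d p then 1 else 0)) := by
      intro i j
      have hpos : 0 ≤ η ^ 2 * L := by positivity
      by_cases hij : i = j
      · rw [if_pos hij]
        positivity
      rw [if_neg hij]
      by_cases hi : i = Fin.castAdd d p ∨ j = Fin.castAdd d p
      · refine mul_le_mul_of_nonneg_left ((hbit _ _).trans ?_) hpos
        rcases hi with h | h
        · rw [if_pos h]; split_ifs <;> norm_num
        · rw [if_pos h]; split_ifs <;> norm_num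
      · rw [not_or] at hi
        rw [hlabeq i hi.1, hlabeq j hi.2, if_neg hi.1, if_neg hi.2]
        simp
    refine (Finset.sum_le_sum fun i _ => Finset.sum_le_sum fun j _ => hle i j).trans ?_
    simp only [← Finset.mul_sum, Finset.sum_add_distrib, Finset.sum_const, Finset.card_univ,
      Fintype.card_fin, nsmul_eq_mul, Finset.sum_ite_eq', Finset.mem_univ, if_true]
    have hcard : Real.log ((Fintype.card (Fin k → ZMod 2) : ℕ) : ℝ) = k * Real.log 2 := by
      simp
    rw [hcard]
    have hlog := Real.log_two_gt_d9
    have hkR : (1 : ℝ) ≤ k := by exact_mod_cast hk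
    have h5 : (k : ℝ) * 0.69 ≤ k * Real.log 2 := by gcongr; linarith
    push_cast at hinfo ⊢
    linarith
  · intro θ θ'
    rw [hdist, Fin.sum_univ_add]
    have hnn : ∀ i j : Fin (m + d), 0 ≤ (if i = j then 0 else η ^ 2 * L *
        (bitValue (lab θ i ⬝ᵥ lab θ j) - bitValue (lab θ' i ⬝ᵥ lab θ' j)) ^ 2) := by
      intro i j; split_ifs <;> positivity
    -- Only pairs of an unknown node and an anchor are kept: the anchor labels do not depend on the
    -- parameter, so wrong labels cannot compensate each other.
    refine le_trans ?_ (le_add_of_nonneg_right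
      (Finset.sum_nonneg fun i _ => Finset.sum_nonneg fun j _ => hnn _ _))
    have hham : (hammingDist θ θ' : ℝ) = ∑ i, if θ i = θ' i then (0 : ℝ) else 1 := by
      simp [hammingDist, Finset.sum_ite]
    rw [hham, Finset.mul_sum]
    refine Finset.sum_le_sum fun i _ => ?_
    rw [Fin.sum_univ_add]
    refine le_trans ?_ (le_add_of_nonneg_left (Finset.sum_nonneg fun j _ => hnn _ _))
    split_ifs with hi
    · rw [mul_zero]
      exact Finset.sum_nonneg fun j _ => hnn _ _
    · rw [mul_one]
      have h1 : ∀ j : Fin d, (if Fin.castAdd d i = Fin.natAdd m j then 0 else η ^ 2 * L *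
          (bitValue (lab θ (Fin.castAdd d i) ⬝ᵥ lab θ (Fin.natAdd m j)) -
            bitValue (lab θ' (Fin.castAdd d i) ⬝ᵥ lab θ' (Fin.natAdd m j))) ^ 2) =
          η ^ 2 * L * (bitValue (θ i ⬝ᵥ anchorLabel hk0 j) -
            bitValue (θ' i ⬝ᵥ anchorLabel hk0 j)) ^ 2 := by
        intro j
        have hne : Fin.castAdd d i ≠ Fin.natAdd m j := by
          intro h
          have := congrArg Fin.val h
          simp at this
          omega
        rw [if_neg hne]
        simp [hlab]
      simp only [h1]
      rw [← Finset.mul_sum]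
      exact mul_le_mul_of_nonneg_left (sum_sq_anchor_ge hk0 hkd hi) (by positivity)
  · rw [Fintype.card_fin]
    push_cast
    have h1 : ((m : ℝ) + d) ^ 2 ≤ 6 * (d * m) := by nlinarith
    calc η ^ 2 / 768 * (((m : ℝ) + d) ^ 2 * L) ≤ η ^ 2 / 768 * (6 * (d * m) * L) := by gcongr
      _ = _ := by ring

/-- The label lower bound for half of `n` nodes with unknown labels. -/
theorem minimaxProb_ge_labelRate {n L k : ℕ} {H : Matrix (Fin L) (Fin L) ℝ}
    (hH : H ∈ Matrix.orthogonalGroup (Fin L) ℝ) (hT : TransformCondition H)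
    {𝓕 : Set (I → I → I → I)} (hn : 2 ≤ n) (hL : 1 ≤ L) (hk : 1 ≤ k) (hkn : 2 * (2 ^ k - 1) ≤ n)
    {ν₂ K₂ g c : ℝ} (hν₂ : 0 < ν₂) (hK₂ : 0 ≤ K₂) (hreal : Realizable H 𝓕 (2 ^ k) ν₂ K₂ g)
    (hc : 0 < c) (hc1 : c ≤ 1 / 2000) (hg : √(c * k / n) ≤ g) :
    1 / 4 ≤ minimaxProb n L 𝓕 (c * k / (768 * (n * L))) := by
  have hLR : (1 : ℝ) ≤ L := by exact_mod_cast hL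
  have hnR : (2 : ℝ) ≤ n := by exact_mod_cast hn
  have hkR : (1 : ℝ) ≤ k := by exact_mod_cast hk
  have hkn' : (k : ℝ) ≤ n := by
    have := Nat.lt_two_pow_self (n := k)
    exact_mod_cast (by omega : k ≤ n)
  obtain ⟨m, d, hmd, hm, h1, h2, h3⟩ : ∃ m d : ℕ, n = m + d ∧ 1 ≤ m ∧ m ≤ d ∧ d ≤ 2 * m ∧
      2 ^ k - 1 ≤ d := ⟨n / 2, n - n / 2, by omega, by omega, by omega, by omega, by omega⟩
  have hsq : √(c * k / (n * L)) ^ 2 = c * k / (n * L) := Real.sq_sqrt (by positivity)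
  have hmain := minimaxProb_ge_of_labels (m := m) (d := d) hH hT (by omega) hm h1 h2 hk h3 hν₂ hK₂
    hreal (η := √(c * k / (n * L))) (by positivity) (by
      rw [show (1 / 4 : ℝ) = √(1 / 16) by
        rw [show (1 / 16 : ℝ) = (1 / 4) ^ 2 by norm_num, Real.sqrt_sq (by norm_num)]]
      apply Real.sqrt_le_sqrt
      rw [div_le_iff₀ (by positivity)]
      nlinarith) (by
      refine le_trans (le_of_eq ?_) hg
      rw [← Real.sqrt_mul (by positivity)]
      congr 1
      field_simp) (by
      rw [hsq, ← hmd]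
      have : 2000 * (c * k / (n * L)) * (n * L) = 2000 * c * k := by field_simp
      rw [this]
      nlinarith)
  rw [hsq, ← hmd] at hmain
  refine hmain.trans_eq ?_
  congr 1
  rw [div_div]
  congr 1
  ring

end Labels

end DynamicGraphon

namespace DynamicGraphon

/-! ### Choice of parameters and the two rates -/

section Rates

/-- The combined threshold is at most the larger of `p A` and `q B`, and the minimax probability
decreases in the threshold. -/
lemma minimaxProb_ge_of_sum {n L : ℕ} {𝓕 : Set (I → I → I → I)} {p q A B : ℝ} (hA : 0 ≤ A)
    (hB : 0 ≤ B) (hpA : 1 / 4 ≤ minimaxProb n L 𝓕 (p * A))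
    (hqB : 1 / 4 ≤ minimaxProb n L 𝓕 (q * B)) :
    1 / 4 ≤ minimaxProb n L 𝓕 (min p q / 2 * (A + B)) := by
  have h1 : min p q * A ≤ p * A := mul_le_mul_of_nonneg_right (min_le_left _ _) hA
  have h2 : min p q * B ≤ q * B := mul_le_mul_of_nonneg_right (min_le_right _ _) hB
  rcases le_total (p * A) (q * B) with h | h
  · exact hqB.trans (minimaxProb_anti (by linarith))
  · exact hpA.trans (minimaxProb_anti (by linarith))

theorem exists_const_minimaxProb_constClass {ν₂ K₂ : ℝ} (hν₂ : 1 / 2 ≤ ν₂) (hK₂ : 0 < K₂) :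
    ∃ C : ℝ, 0 < C ∧ ∀ (n L r : ℕ), 1 ≤ L → 2 ≤ r → r ≤ n →
      ∀ H : Matrix (Fin L) (Fin L) ℝ, H ∈ Matrix.orthogonalGroup (Fin L) ℝ →
        TransformCondition H →
          1 / 4 ≤ minimaxProb n L (constClass H r ν₂ K₂) (C * constRate n L r ν₂) := by
  refine ⟨min (min (1 / 5000) K₂ / 512) (1 / 2000 / 2304) / 2, by positivity, ?_⟩
  intro n L r hL hr hrn H hH hT
  have hLR : (1 : ℝ) ≤ L := by exact_mod_cast hL
  have hrR : (2 : ℝ) ≤ r := by exact_mod_cast hr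
  have hrnR : (r : ℝ) ≤ n := by exact_mod_cast hrn
  have hnR : (2 : ℝ) ≤ n := hrR.trans hrnR
  have hν₂0 : 0 < ν₂ := by linarith
  unfold constRate
  refine minimaxProb_ge_of_sum (by positivity)
    (div_nonneg (Real.log_nonneg (by linarith)) (by positivity)) ?_ ?_
  · refine minimaxProb_ge_blockRate hH hT hr hrn hL hν₂
      (realizable_constClass hH hT (by omega) le_rfl hν₂0 hK₂.le _) (by positivity)
      (pow_le_one₀ (by positivity) ((div_le_one (by linarith)).2 hrnR)) ?_ (by positivity)
      (min_le_left _ _) (min_le_right _ _) le_rfl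
    rw [← mul_pow, div_mul_div_comm, mul_comm (r : ℝ), div_self (by positivity), one_pow]
  · set k := Nat.log 2 (r / 2 + 1) with hk
    have hk1 : 1 ≤ k := Nat.log_pos (by norm_num) (by omega)
    have hk2 : 2 ^ k ≤ r / 2 + 1 := Nat.pow_log_le_self 2 (by omega)
    have hk3 : r / 2 + 1 < 2 ^ (k + 1) := Nat.lt_pow_succ_log_self (by norm_num) _
    -- Since `k ≥ 1`, `k + 2 ≤ 3 k`; the resulting `log r ≤ 3 k` turns 768 into 2304.
    have hk4 : r ≤ 2 ^ (3 * k) := by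
      have h1 : r ≤ 2 ^ (k + 2) := by rw [pow_succ]; omega
      exact h1.trans (Nat.pow_le_pow_right (by norm_num) (by omega))
    have hlog : Real.log r ≤ 3 * k := by
      have h1 : Real.log r ≤ Real.log ((2 : ℝ) ^ (3 * k)) :=
        Real.log_le_log (by linarith) (by exact_mod_cast hk4)
      rw [Real.log_pow] at h1
      push_cast at h1
      have h2 := Real.log_two_lt_d9
      have h3 : (3 * k : ℝ) * Real.log 2 ≤ 3 * k * 1 := by gcongr; linarith
      linarith
    have hmain := minimaxProb_ge_labelRate (n := n) (L := L) (c := 1 / 2000) hH hT (by omega) hL hk1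
      (by omega) hν₂0 hK₂.le
      (realizable_constClass (r := r) hH hT (by omega) (by omega) hν₂0 hK₂.le _) (by norm_num) le_rfl le_rfl
    refine hmain.trans (minimaxProb_anti ?_)
    calc 1 / 2000 / 2304 * (Real.log r / (n * L)) ≤ 1 / 2000 / 2304 * (3 * k / (n * L)) := by gcongr
      _ = _ := by field_simp; norm_num

lemma le_two_mul_rpow_neg {h y ν : ℝ} (hh : 0 < h) (hy : 0 < y) (hν : 0 < ν) (hhy : h ≤ 2 * y) :
    (2 : ℝ) ^ (-ν) * y ^ (-ν) ≤ h ^ (-ν) := by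
  rw [← Real.mul_rpow (by norm_num) hy.le]
  exact Real.rpow_le_rpow_of_nonpos hh hhy (by linarith)

theorem exists_const_minimaxProb_smoothClass {ν₁ ν₂ K₁ K₂ : ℝ} (hν₁ : 0 < ν₁) (hν₂ : 1 / 2 ≤ ν₂)
    (hK₁ : 0 < K₁) (hK₂ : 0 < K₂) :
    ∃ C : ℝ, 0 < C ∧ ∀ (n L r : ℕ), 2 ≤ n → 1 ≤ L → 1 ≤ r →
      ∀ H : Matrix (Fin L) (Fin L) ℝ, H ∈ Matrix.orthogonalGroup (Fin L) ℝ →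
        TransformCondition H →
          1 / 4 ≤ minimaxProb n L (smoothClass H r ν₁ ν₂ K₁ K₂) (C * smoothRate n L ν₁ ν₂) := by
  obtain ⟨c, hc, hreal⟩ := exists_realizable_smoothClass hν₁ hK₁
  -- The factor `2^(-ν₁)` pays for rounding: below, the number of cells is at most `2 y`, not `y`.
  set κ : ℝ := c * (2 : ℝ) ^ (-ν₁) with hκ
  have hκ0 : 0 < κ := by positivity
  set c₁ : ℝ := min (min (1 / 5000) K₂) (κ ^ 2) with hc₁
  set c₂ : ℝ := min (1 / 2000) (κ ^ 2 / 2) with hc₂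
  have hc₁0 : 0 < c₁ := by positivity
  have hc₂0 : 0 < c₂ := by positivity
  refine ⟨min (c₁ / 512) (c₂ / (768 * (4 * ν₁ + 4))) / 2, by positivity, ?_⟩
  intro n L r hn hL hr H hH hT
  have hLR : (1 : ℝ) ≤ L := by exact_mod_cast hL
  have hnR : (2 : ℝ) ≤ n := by exact_mod_cast hn
  have hn0 : (0 : ℝ) < n := by linarith
  have hν₂0 : 0 < ν₂ := by linarith
  unfold smoothRate
  refine minimaxProb_ge_of_sum (by positivity)
    (div_nonneg (Real.log_nonneg (by linarith)) (by positivity)) ?_ ?_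
  · set ε : ℝ := (1 / (n : ℝ) ^ 2) ^ (ν₁ / (ν₁ + 1)) with hε
    have hε0 : 0 < ε := by positivity
    -- At `y` cells the Hölder amplitude `y^(-ν₁)` equals the detection threshold `y/n`, and its
    -- square is `ε`.
    set y : ℝ := (n : ℝ) ^ (1 / (ν₁ + 1)) with hy
    have hy0 : 0 < y := by positivity
    have hy1 : 1 ≤ y := Real.one_le_rpow (by linarith) (by positivity)
    have hyn : y < n := by
      calc y < (n : ℝ) ^ (1 : ℝ) := Real.rpow_lt_rpow_of_exponent_lt (by linarith)
            ((div_lt_one (by linarith)).2 (by linarith))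
        _ = n := Real.rpow_one _
    have hn2 : 1 / (n : ℝ) ^ 2 = (n : ℝ) ^ (-2 : ℝ) := by
      rw [Real.rpow_neg hn0.le, Real.rpow_two, one_div]
    have hεy : ε = (y ^ (-ν₁)) ^ 2 := by
      rw [hε, hn2, hy, ← Real.rpow_mul hn0.le, ← Real.rpow_mul hn0.le, ← Real.rpow_natCast,
        ← Real.rpow_mul hn0.le]
      congr 1
      push_cast
      field_simp
    have hny : (n : ℝ) * y ^ (-ν₁) = y := by
      have : (n : ℝ) = y ^ (ν₁ + 1) := by
        rw [hy, ← Real.rpow_mul hn0.le, one_div_mul_cancel (by positivity), Real.rpow_one]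
      nth_rewrite 1 [this]
      rw [← Real.rpow_add hy0, show ν₁ + 1 + -ν₁ = 1 by ring, Real.rpow_one]
    -- Rounding up keeps `y/h ≤ 1` and `h ≥ 2`; `h ≤ n` holds because `y < n` strictly.
    set h : ℕ := ⌊y⌋₊ + 1 with hh
    have hfl : 1 ≤ ⌊y⌋₊ := (Nat.one_le_floor_iff _).2 hy1
    have hfly : (⌊y⌋₊ : ℝ) ≤ y := Nat.floor_le hy0.le
    have hyh : y ≤ h := by rw [hh]; push_cast; exact (Nat.lt_floor_add_one y).le
    have hhy : (h : ℝ) ≤ 2 * y := by rw [hh]; push_cast; linarith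
    have hhn : h ≤ n := Nat.succ_le_of_lt ((Nat.floor_lt hy0.le).2 hyn)
    have hh0 : (0 : ℝ) < h := by linarith
    have hexp : (1 / (n : ℝ) ^ 2) ^ (2 * ν₁ * ν₂ / ((ν₁ + 1) * (2 * ν₂ + 1))) =
        ε ^ (2 * ν₂ / (2 * ν₂ + 1)) := by
      rw [hε, ← Real.rpow_mul (by positivity)]
      congr 1
      field_simp
    rw [hexp]
    refine minimaxProb_ge_blockRate hH hT (by omega) hhn hL hν₂
      (hreal hH hT (by omega) hr hν₂0 hK₂.le) hε0 ?_ ?_ hc₁0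
      ((min_le_left _ _).trans (min_le_left _ _)) ((min_le_left _ _).trans (min_le_right _ _)) ?_
    · refine Real.rpow_le_one (by positivity) ?_ (by positivity)
      rw [div_le_one (by positivity)]
      nlinarith
    · rw [hεy, ← mul_pow, mul_div_assoc', mul_comm (y ^ (-ν₁)), hny]
      exact pow_le_one₀ (by positivity) ((div_le_one hh0).2 hyh)
    · rw [Real.sqrt_mul hc₁0.le, hεy, Real.sqrt_sq (by positivity)]
      have h1 : √c₁ ≤ κ := Real.sqrt_le_iff.2 ⟨hκ0.le, min_le_right _ _⟩
      calc √c₁ * y ^ (-ν₁) ≤ κ * y ^ (-ν₁) := by gcongr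
        _ = c * ((2 : ℝ) ^ (-ν₁) * y ^ (-ν₁)) := by rw [hκ]; ring
        _ ≤ _ := by gcongr; exact le_two_mul_rpow_neg hh0 hy0 hν₁ hhy
  -- A small power of `n` is enough, as only `log y` enters the rate. The exponent gives both `y⁴ ≤
  -- n`, leaving room for the anchors, and `y/n ≤ y^(-2ν₁)`, so that the label signal respects the
  -- Hölder amplitude.
  · set y : ℝ := (n : ℝ) ^ (1 / (4 * ν₁ + 4)) with hy
    have hy0 : 0 < y := by positivity
    have hy1 : 1 ≤ y := Real.one_le_rpow (by linarith) (by positivity)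
    have hny : (n : ℝ) = y ^ (4 * ν₁ + 4) := by
      rw [hy, ← Real.rpow_mul hn0.le, one_div_mul_cancel (by positivity), Real.rpow_one]
    have hy4 : y ^ 4 ≤ n := by
      rw [hny, ← Real.rpow_natCast]
      exact Real.rpow_le_rpow_of_exponent_le hy1 (by push_cast; linarith)
    have hfl : 1 ≤ ⌊y⌋₊ := (Nat.one_le_floor_iff _).2 hy1
    have hfly : (⌊y⌋₊ : ℝ) ≤ y := Nat.floor_le hy0.le
    set k := Nat.log 2 ⌊y⌋₊ + 1 with hk
    have hk1 : 1 ≤ k := by omega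
    have hk2 : 2 ^ k ≤ 2 * ⌊y⌋₊ := by
      rw [hk, pow_succ, mul_comm]
      exact Nat.mul_le_mul_left _ (Nat.pow_log_le_self 2 (by omega))
    have hk3 : ⌊y⌋₊ + 1 ≤ 2 ^ k := Nat.lt_pow_succ_log_self (by norm_num) _
    have hk2R : ((2 ^ k : ℕ) : ℝ) ≤ 2 * y := by
      have : ((2 ^ k : ℕ) : ℝ) ≤ ((2 * ⌊y⌋₊ : ℕ) : ℝ) := by exact_mod_cast hk2
      rw [Nat.cast_mul, Nat.cast_two] at this
      linarith
    have hk3R : y ≤ (2 : ℝ) ^ k := by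
      have : ((⌊y⌋₊ + 1 : ℕ) : ℝ) ≤ ((2 ^ k : ℕ) : ℝ) := by exact_mod_cast hk3
      push_cast at this
      linarith [Nat.lt_floor_add_one y]
    have hM4 : (2 ^ k) ^ 4 ≤ 16 * n := by
      have : (((2 ^ k : ℕ) : ℝ)) ^ 4 ≤ 16 * n := by
        calc (((2 ^ k : ℕ) : ℝ)) ^ 4 ≤ (2 * y) ^ 4 := by gcongr
          _ = 16 * y ^ 4 := by ring
          _ ≤ _ := by gcongr
      exact_mod_cast this
    have hkn : 2 * (2 ^ k - 1) ≤ n := by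
      rcases Nat.lt_or_ge k 2 with h | h
      · have : k = 1 := by omega
        rw [this]
        omega
      · have h4 : 2 ^ 2 ≤ 2 ^ k := Nat.pow_le_pow_right (by norm_num) h
        have h64 : (2 ^ 2) ^ 3 * 2 ^ k ≤ (2 ^ k) ^ 3 * 2 ^ k :=
          Nat.mul_le_mul_right _ (Nat.pow_le_pow_left h4 3)
        have h65 : (2 ^ k) ^ 3 * 2 ^ k = (2 ^ k) ^ 4 := (pow_succ _ _).symm
        omega
    have hkpow : (k : ℝ) ≤ 2 * y :=
      le_trans (by exact_mod_cast (Nat.lt_two_pow_self (n := k)).le) hk2R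
    have hlog : Real.log n ≤ (4 * ν₁ + 4) * k := by
      rw [hny, Real.log_rpow hy0]
      have h1 := Real.log_le_log hy0 hk3R
      rw [Real.log_pow] at h1
      have h2 := Real.log_two_lt_d9
      have h3 : (k : ℝ) * Real.log 2 ≤ k * 1 := by gcongr; linarith
      gcongr
      linarith
    have hMpos : (0 : ℝ) < ((2 ^ k : ℕ) : ℝ) := by positivity
    have hmain := minimaxProb_ge_labelRate (n := n) (L := L) (c := c₂) hH hT hn hL hk1 hkn hν₂0
      hK₂.le (hreal (h := 2 ^ k) (r := r) hH hT (by positivity) hr hν₂0 hK₂.le) hc₂0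
      (min_le_left _ _) (by
        have h1 : c₂ * k / n ≤ (κ * y ^ (-ν₁)) ^ 2 := by
          have h2 : y / n ≤ (y ^ (-ν₁)) ^ 2 := by
            rw [hny, ← Real.rpow_natCast, ← Real.rpow_mul hy0.le]
            nth_rewrite 1 [← Real.rpow_one y]
            rw [← Real.rpow_sub hy0]
            exact Real.rpow_le_rpow_of_exponent_le hy1 (by push_cast; linarith)
          calc c₂ * k / n ≤ κ ^ 2 / 2 * (2 * y) / n := by gcongr; exact min_le_right _ _
            _ = κ ^ 2 * (y / n) := by ring
            _ ≤ κ ^ 2 * (y ^ (-ν₁)) ^ 2 := by gcongr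
            _ = _ := by ring
        calc √(c₂ * k / n) ≤ κ * y ^ (-ν₁) := Real.sqrt_le_iff.2 ⟨by positivity, h1⟩
          _ = c * ((2 : ℝ) ^ (-ν₁) * y ^ (-ν₁)) := by rw [hκ]; ring
          _ ≤ _ := by gcongr; exact le_two_mul_rpow_neg hMpos hy0 hν₁ hk2R)
    refine hmain.trans (minimaxProb_anti ?_)
    calc c₂ / (768 * (4 * ν₁ + 4)) * (Real.log n / (n * L))
        ≤ c₂ / (768 * (4 * ν₁ + 4)) * ((4 * ν₁ + 4) * k / (n * L)) := by gcongr
      _ = _ := by field_simp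

end Rates

end DynamicGraphon

theorem theorem7 :
    (∀ ν₂ K₂ : ℝ, 1 / 2 ≤ ν₂ → 0 < K₂ →
      ∃ C : ℝ, 0 < C ∧
        ∀ (n L r : ℕ), 1 ≤ L → 2 ≤ r → r ≤ n →
        ∀ H : Matrix (Fin L) (Fin L) ℝ, H ∈ Matrix.orthogonalGroup (Fin L) ℝ →
          DynamicGraphon.TransformCondition H →
          1 / 4 ≤ DynamicGraphon.minimaxProb n L (DynamicGraphon.constClass H r ν₂ K₂)
            (C * DynamicGraphon.constRate n L r ν₂)) ∧
    (∀ ν₁ ν₂ K₁ K₂ : ℝ, 0 < ν₁ → 1 / 2 ≤ ν₂ → 0 < K₁ → 0 < K₂ →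
      ∃ C : ℝ, 0 < C ∧
        ∀ (n L r : ℕ), 2 ≤ n → 1 ≤ L → 1 ≤ r →
        ∀ H : Matrix (Fin L) (Fin L) ℝ, H ∈ Matrix.orthogonalGroup (Fin L) ℝ →
          DynamicGraphon.TransformCondition H →
          1 / 4 ≤ DynamicGraphon.minimaxProb n L (DynamicGraphon.smoothClass H r ν₁ ν₂ K₁ K₂)
            (C * DynamicGraphon.smoothRate n L ν₁ ν₂)) :=
  ⟨fun _ _ hν hK => DynamicGraphon.exists_const_minimaxProb_constClass hν hK,
    fun _ _ _ _ hν₁ hν₂ hK₁ hK₂ =>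
      DynamicGraphon.exists_const_minimaxProb_smoothClass hν₁ hν₂ hK₁ hK₂⟩
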